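/- A lattice homomorphism $g\colon A\to D$ is lower bounded if for every $d\in D$ the set $\{x\in A : g(x)\ge d\}$ is empty or has a least element. A lattice $D$ is lower bounded if there are a finite set $X$ and a lower bounded epimorphism $F(X)\to D$ from the free lattice $F(X)$. A lattice $D$ with finite generating set $X$ satisfies Dean's condition (D) if for all non-empty finite $S,T\subseteq D$ with $\bigwedge S\le\bigvee T$ there is $s\in S$ with $s\le\bigvee T$, or $t\in T$ with $\bigwedge S\le t$, or $p\in X$ with $\bigwedge S\le p\le\bigvee T$. **Theorem.** Below, "exponential time" means at most $2^{p(N)}$ steps for some polynomial $p$, where $N$ is the size of the input (numbers of generators and indices of variables being written in unary). Steps are counted for programs of first-order LISP over binary trees, a model that is polynomially equivalent to Turing machines. 1. There is an algorithm that, given a finite lattice presentation (finitely many generators and finitely many equations between lattice terms), decides in exponential time whether the presented lattice is lower bounded. 2. There is an algorithm that, given a finite lattice presentation of a lattice $L$ and a finite list of lattice terms in its generators such that the sublattice $D$ of $L$ generated by the set $X$ of elements denoted by these terms satisfies (D) for the generating set $X$, decides in exponential time whether $D$ is lower bounded. 3. Let $L$ be given by a finite presentation, let $P\subseteq L$ be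 the finite set of the elements denoted by the generators and by the subterms of the terms in the defining equations, and let $S=P^{\vee}$ be the set of all joins in $L$ of finite subsets of $P$ (the empty join being the least element of $L$). With the order of $L$, $S$ is a finite lattice; the standard map $f\colon L\to S$, $f(d)=\bigvee\{w\in S : w\le d\}$, is a lower bounded lattice epimorphism; and $L$ is lower bounded if and only if the finite lattice $S$ is lower bounded. -/

import Mathlib

namespace LatDec

/-! ### Lattice terms, free lattices and presented lattices -/

/-- Lattice terms over a set `α` of variables. -/
inductive Term (α : Type) : Type
  | var : α → Term α
  | sup : Term α → Term α → Term α
  | inf : Term α → Term α → Term α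

/-- The set of subterms of a term (the term itself included). -/
def Term.subterms {α : Type} : Term α → Set (Term α)
  | .var a => {.var a}
  | .sup s t => {.sup s t} ∪ (s.subterms ∪ t.subterms)
  | .inf s t => {.inf s t} ∪ (s.subterms ∪ t.subterms)

/-- The least relation on terms that is forced by the lattice laws together with the equations
`s = t`, `(s, t) ∈ R`: `TermLE R s t` says that `s ≤ t` is a consequence of `R`. -/
inductive TermLE {α : Type} (R : Set (Term α × Term α)) : Term α → Term α → Prop
  | refl (s : Term α) : TermLE R s s
  | trans {s t u : Term α} : TermLE R s t → TermLE R t u → TermLE R s u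
  | inf_left (s t : Term α) : TermLE R (.inf s t) s
  | inf_right (s t : Term α) : TermLE R (.inf s t) t
  | le_inf {s t u : Term α} : TermLE R u s → TermLE R u t → TermLE R u (.inf s t)
  | left_sup (s t : Term α) : TermLE R s (.sup s t)
  | right_sup (s t : Term α) : TermLE R t (.sup s t)
  | sup_le {s t u : Term α} : TermLE R s u → TermLE R t u → TermLE R (.sup s t) u
  | rel_le {s t : Term α} : (s, t) ∈ R → TermLE R s t
  | rel_ge {s t : Term α} : (s, t) ∈ R → TermLE R t s

/-- Two terms are identified when each is below the other. -/
def termSetoid {α : Type} (R : Set (Term α × Term α)) : Setoid (Term α) where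
  r s t := TermLE R s t ∧ TermLE R t s
  iseqv := ⟨fun s => ⟨.refl s, .refl s⟩, fun h => ⟨h.2, h.1⟩,
    fun h k => ⟨h.1.trans k.1, k.2.trans h.2⟩⟩

/-- The lattice presented by the generators `α` and the relations `s = t`, `(s, t) ∈ R`, that is,
the free lattice over `α` modulo the congruence generated by `R`. -/
def Presented (α : Type) (R : Set (Term α × Term α)) : Type :=
  Quotient (termSetoid R)

/-- The element of the presented lattice that a term denotes. -/
def Presented.mk {α : Type} (R : Set (Term α × Term α)) (s : Term α) : Presented α R :=
  Quotient.mk (termSetoid R) s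

instance Presented.instLattice {α : Type} (R : Set (Term α × Term α)) :
    Lattice (Presented α R) where
  le := Quotient.lift₂ (TermLE R) (fun _ _ _ _ h k => propext
    ⟨fun m => (h.2.trans m).trans k.1, fun m => (h.1.trans m).trans k.2⟩)
  le_refl := by rintro ⟨s⟩; exact .refl s
  le_trans := by rintro ⟨s⟩ ⟨t⟩ ⟨u⟩ h k; exact TermLE.trans h k
  le_antisymm := by rintro ⟨s⟩ ⟨t⟩ h k; exact Quotient.sound ⟨h, k⟩
  sup := Quotient.map₂ Term.sup (fun _ _ h _ _ k =>
    ⟨.sup_le (h.1.trans (.left_sup _ _)) (k.1.trans (.right_sup _ _)),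
     .sup_le (h.2.trans (.left_sup _ _)) (k.2.trans (.right_sup _ _))⟩)
  le_sup_left := by rintro ⟨s⟩ ⟨t⟩; exact .left_sup s t
  le_sup_right := by rintro ⟨s⟩ ⟨t⟩; exact .right_sup s t
  sup_le := by rintro ⟨s⟩ ⟨t⟩ ⟨u⟩ h k; exact TermLE.sup_le h k
  inf := Quotient.map₂ Term.inf (fun _ _ h _ _ k =>
    ⟨.le_inf ((TermLE.inf_left _ _).trans h.1) ((TermLE.inf_right _ _).trans k.1),
     .le_inf ((TermLE.inf_left _ _).trans h.2) ((TermLE.inf_right _ _).trans k.2)⟩)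
  inf_le_left := by rintro ⟨s⟩ ⟨t⟩; exact .inf_left s t
  inf_le_right := by rintro ⟨s⟩ ⟨t⟩; exact .inf_right s t
  le_inf := by rintro ⟨s⟩ ⟨t⟩ ⟨u⟩ h k; exact TermLE.le_inf h k

/-- The free lattice over `α`. -/
abbrev FreeLattice (α : Type) : Type := Presented α ∅

/-! ### Lower boundedness and Dean's condition -/

/-- `g : A → D` is lower bounded if for each `d` the set `{x | g x ≥ d}` is empty or has a least
element. -/
def IsLowerBoundedHom {A D : Type} [Lattice A] [Lattice D] (g : LatticeHom A D) : Prop :=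
  ∀ d : D, {x : A | d ≤ g x} = ∅ ∨ ∃ a : A, IsLeast {x : A | d ≤ g x} a

/-- `D` is lower bounded if it is the image of a free lattice over a finite set under a lower
bounded epimorphism. -/
def IsLowerBoundedLattice (D : Type) [Lattice D] : Prop :=
  ∃ (n : ℕ) (f : LatticeHom (FreeLattice (Fin n)) D),
    Function.Surjective f ∧ IsLowerBoundedHom f

/-- Dean's condition (D) of a lattice `D` with respect to the generating set `P`. -/
def DeanCondition {D : Type} [Lattice D] (P : Set D) : Prop :=
  ∀ (S T : Finset D) (hS : S.Nonempty) (hT : T.Nonempty),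
    S.inf' hS id ≤ T.sup' hT id →
      (∃ s ∈ S, s ≤ T.sup' hT id) ∨
      (∃ t ∈ T, S.inf' hS id ≤ t) ∨
      (∃ p ∈ P, S.inf' hS id ≤ p ∧ p ≤ T.sup' hT id)

/-- The sublattice generated by a set. -/
def generated {L : Type} [Lattice L] (X : Set L) : Sublattice L :=
  sInf {M : Sublattice L | X ⊆ M}

/-- The set `W^∨` of all joins of finite subsets of `W`; the join of the empty set is the least
element of the lattice. -/
def joins {L : Type} [Lattice L] (W : Set L) : Set L :=
  {x | ∃ U : Finset L, (U : Set L) ⊆ W ∧ IsLUB (U : Set L) x}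

/-! ### Finite presentations, and finite sets of elements given by terms -/

/-- A finite lattice presentation: generators `0, …, n - 1` and finitely many relations `s = t`. -/
structure FinPres where
  n : ℕ
  rels : List (Term (Fin n) × Term (Fin n))

/-- The relations as a set. -/
def FinPres.relSet (Q : FinPres) : Set (Term (Fin Q.n) × Term (Fin Q.n)) := {r | r ∈ Q.rels}

/-- The finitely presented lattice. -/
abbrev FinPres.Lat (Q : FinPres) : Type := Presented (Fin Q.n) Q.relSet

/-- The finite set of the elements of `Q.Lat` that are denoted by the generators and by the
subterms of the terms occurring in the relations. -/
def FinPres.partialLat (Q : FinPres) : Set Q.Lat :=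
  Presented.mk Q.relSet ''
    (Set.range Term.var ∪ {u | ∃ r ∈ Q.rels, u ∈ r.1.subterms ∪ r.2.subterms})

/-- A finite presentation together with a finite list of terms, that is, of elements of the
presented lattice. -/
structure SubPres where
  pres : FinPres
  gens : List (Term (Fin pres.n))

/-- The elements of the presented lattice denoted by the listed terms. -/
def SubPres.genSet (Q : SubPres) : Set Q.pres.Lat :=
  {x | ∃ s ∈ Q.gens, x = Presented.mk Q.pres.relSet s}

/-- The finitely generated sublattice of the presented lattice that the listed terms generate. -/
abbrev SubPres.Sub (Q : SubPres) : Type := generated Q.genSet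

/-- This sublattice satisfies Dean's condition for the given generating set. -/
def SubPres.Dean (Q : SubPres) : Prop :=
  DeanCondition {x : Q.Sub | (x : Q.pres.Lat) ∈ Q.genSet}

/-! ### The model of computation

Programs of first-order LISP over binary trees, with a count of evaluation steps. Every step
creates at most one new cell and follows a bounded number of pointers (trees are never copied or
compared), so up to a polynomial this is the running time of a Turing machine. -/

/-- Binary trees (S-expressions with the single atom `nil`). -/
inductive Val : Type
  | nil : Val
  | node : Val → Val → Val

/-- The number of nodes of a tree: the size of an input. -/
def Val.size : Val → ℕ
  | .nil => 1
  | .node l r => l.size + r.size + 1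

def Val.left : Val → Val
  | .nil => .nil
  | .node l _ => l

def Val.right : Val → Val
  | .nil => .nil
  | .node _ r => r

/-- Expressions. Variables are de Bruijn indices into the list of local values; `letE a b`
evaluates `b` with the value of `a` as the new variable `0`; `call f a` calls the `f`-th function
of the program, whose only variable is its argument; `ite c a b` tests whether `c` is not `nil`. -/
inductive Exp : Type
  | var : ℕ → Exp
  | nil : Exp
  | cons : Exp → Exp → Exp
  | hd : Exp → Exp
  | tl : Exp → Exp
  | ite : Exp → Exp → Exp → Exp
  | letE : Exp → Exp → Exp
  | call : ℕ → Exp → Exp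

/-- A program is the list of the bodies of its (mutually recursive) functions. -/
abbrev Program : Type := List Exp

/-- `Evals P ρ e v t`: with the local values `ρ`, the expression `e` evaluates to `v` in exactly
`t` steps. -/
inductive Evals (P : Program) : List Val → Exp → Val → ℕ → Prop
  | var (ρ : List Val) (i : ℕ) : Evals P ρ (.var i) (ρ.getD i .nil) 1
  | nil (ρ : List Val) : Evals P ρ .nil .nil 1
  | cons {ρ : List Val} {a b : Exp} {u v : Val} {s t : ℕ} :
      Evals P ρ a u s → Evals P ρ b v t → Evals P ρ (.cons a b) (.node u v) (s + t + 1)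
  | hd {ρ : List Val} {a : Exp} {u : Val} {s : ℕ} :
      Evals P ρ a u s → Evals P ρ (.hd a) u.left (s + 1)
  | tl {ρ : List Val} {a : Exp} {u : Val} {s : ℕ} :
      Evals P ρ a u s → Evals P ρ (.tl a) u.right (s + 1)
  | ite_true {ρ : List Val} {c a b : Exp} {x y v : Val} {s t : ℕ} :
      Evals P ρ c (.node x y) s → Evals P ρ a v t → Evals P ρ (.ite c a b) v (s + t + 1)
  | ite_false {ρ : List Val} {c a b : Exp} {v : Val} {s t : ℕ} :
      Evals P ρ c .nil s → Evals P ρ b v t → Evals P ρ (.ite c a b) v (s + t + 1)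
  | letE {ρ : List Val} {a b : Exp} {u v : Val} {s t : ℕ} :
      Evals P ρ a u s → Evals P (u :: ρ) b v t → Evals P ρ (.letE a b) v (s + t + 1)
  | call {ρ : List Val} {f : ℕ} {a : Exp} {u v : Val} {s t : ℕ} :
      Evals P ρ a u s → Evals P [u] (P.getD f .nil) v t → Evals P ρ (.call f a) v (s + t + 1)

/-- Among the inputs `i : I` with `promise i`, the property `answer` is decidable in exponential
time: one program, started with the encoded input as the argument of its function `0`, halts within
`2 ^ p(size of the encoded input)` steps for a polynomial `p`, and its result is not `nil` exactly
when the answer is yes. -/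
def DecidableInExpTime {I : Type} (encode : I → Val) (promise answer : I → Prop) : Prop :=
  ∃ (P : Program) (p : Polynomial ℕ), ∀ i : I, promise i →
    ∃ (v : Val) (t : ℕ), Evals P [encode i] (P.getD 0 .nil) v t ∧
      t ≤ 2 ^ p.eval (encode i).size ∧ (v ≠ .nil ↔ answer i)

/-! ### Encoding of the inputs -/

/-- Numbers in unary. -/
def encodeNat : ℕ → Val
  | 0 => .nil
  | k + 1 => .node .nil (encodeNat k)

def encodeList {α : Type} (enc : α → Val) : List α → Val
  | [] => .nil
  | a :: l => .node (enc a) (encodeList enc l)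

/-- Terms; the first component tells variables, joins and meets apart. -/
def encodeTerm {n : ℕ} : Term (Fin n) → Val
  | .var i => .node (encodeNat 0) (encodeNat i)
  | .sup s t => .node (encodeNat 1) (.node (encodeTerm s) (encodeTerm t))
  | .inf s t => .node (encodeNat 2) (.node (encodeTerm s) (encodeTerm t))

def FinPres.encode (Q : FinPres) : Val :=
  .node (encodeNat Q.n) (encodeList (fun r => .node (encodeTerm r.1) (encodeTerm r.2)) Q.rels)

def SubPres.encode (Q : SubPres) : Val :=
  .node Q.pres.encode (encodeList encodeTerm Q.gens)

end LatDec

/-! The theorem rests on describing which elements have least preimages under a map out of a free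
lattice, and on the fact that Dean's condition makes it sufficient to look at generators.

Let `g` map a finitely generated free lattice onto a finite lattice `S`. The elements `s` for which
`{x | s ≤ g x}` has a least element do not depend on `g`: they form the least set `good S` closed
under `CoverStep`, where `s` is admitted once every nontrivial cover `s ≤ u ⊔ v` can be refined by
elements that are already admitted. Good elements have least preimages because finitely many joins
of earlier least preimages suffice as candidates (`exists_isLeast_of_mem_good`). Conversely,
Whitman's condition shows that a term for a least preimage contains terms for the least preimages of
the members of minimal covers, and induction on the size of the term applies
(`mem_good_of_isLeast`).

If `D` satisfies Dean's condition for a finite generating set `X`, then least preimages of the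
members of `X` yield least preimages of all elements (`exists_isLeast_of_dean`). Hence, for a
homomorphism `φ` onto a finite lattice that reflects the inequalities `p ≤ d` with `p ∈ X`, lower
boundedness of `D` means that `φ` maps `X` into the good elements (`isLowerBoundedLattice_iff`).

Such a `φ` exists for presented lattices. Let `T` be a finite set of terms that is closed under
subterms and contains the variables and the sides of the relations. Sending `d` to the ideal of all
terms in `T` that lie below `d` is a homomorphism to the finite lattice of ideals of `T`
(`TermIdeal.mem_hom`). Dean's condition for the presented lattice itself is proved by doubling an
interval (`deanCondition_presented`). The image of `φ` is a copy of `P^∨`, with joins as the left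
adjoint of `φ`, which gives the third claim.

For the algorithm, the order on `T`, the ideals, the generated sublattice and the good elements are
all obtained by filtering lists and by fixed points of monotone operators on them. This is
polynomial in the list of all subsets of `T`, and that list has exponential size. -/

namespace LatDec

/-! ### Presented lattices -/

namespace Presented

variable {α : Type} {R : Set (Term α × Term α)}

theorem mk_le_mk {s t : Term α} : mk R s ≤ mk R t ↔ TermLE R s t := Iff.rfl

theorem mk_sup (s t : Term α) : mk R (.sup s t) = mk R s ⊔ mk R t := rfl

theorem mk_inf (s t : Term α) : mk R (.inf s t) = mk R s ⊓ mk R t := rfl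

theorem mk_le_mk_sup_left (s t : Term α) : mk R s ≤ mk R (.sup s t) := TermLE.left_sup s t

theorem mk_le_mk_sup_right (s t : Term α) : mk R t ≤ mk R (.sup s t) := TermLE.right_sup s t

theorem mk_inf_le_left (s t : Term α) : mk R (.inf s t) ≤ mk R s := TermLE.inf_left s t

theorem mk_inf_le_right (s t : Term α) : mk R (.inf s t) ≤ mk R t := TermLE.inf_right s t

theorem mk_surjective : Function.Surjective (mk R) := fun x => Quotient.exists_rep x

end Presented

open Presented

/-- The value of a term under an assignment of elements of a lattice to the variables. -/
def Term.eval {α L : Type} [Lattice L] (x : α → L) : Term α → L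
  | .var a => x a
  | .sup s t => s.eval x ⊔ t.eval x
  | .inf s t => s.eval x ⊓ t.eval x

theorem TermLE.eval_le {α L : Type} [Lattice L] {R : Set (Term α × Term α)} {x : α → L}
    (hR : ∀ r ∈ R, r.1.eval x = r.2.eval x) {s t : Term α} (h : TermLE R s t) :
    s.eval x ≤ t.eval x := by
  induction h with
  | refl s => exact le_rfl
  | trans _ _ h k => exact h.trans k
  | inf_left s t => exact inf_le_left
  | inf_right s t => exact inf_le_right
  | le_inf _ _ h k => exact _root_.le_inf h k
  | left_sup s t => exact le_sup_left
  | right_sup s t => exact le_sup_right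
  | sup_le _ _ h k => exact _root_.sup_le h k
  | rel_le h => exact (hR _ h).le
  | rel_ge h => exact (hR _ h).ge

/-- The homomorphism out of a presented lattice given by an assignment that satisfies the
relations. -/
def Presented.lift {α L : Type} [Lattice L] {R : Set (Term α × Term α)} (x : α → L)
    (hR : ∀ r ∈ R, r.1.eval x = r.2.eval x) : LatticeHom (Presented α R) L where
  toFun := Quotient.lift (Term.eval x) fun _ _ h =>
    le_antisymm (h.1.eval_le hR) (h.2.eval_le hR)
  map_sup' := by rintro ⟨s⟩ ⟨t⟩; rfl
  map_inf' := by rintro ⟨s⟩ ⟨t⟩; rfl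

/-- The homomorphism out of the free lattice that extends an assignment. -/
def freeLift {α L : Type} [Lattice L] (x : α → L) : LatticeHom (FreeLattice α) L :=
  Presented.lift x (fun _ h => h.elim)

/-- When the interval `[a, b]` of a presented lattice is doubled, `UpperHalf a b t` says that the
value of `t` in the doubled lattice lies above the upper copy of `a`. -/
def UpperHalf {α : Type} {R : Set (Term α × Term α)} (a b : Presented α R) : Term α → Prop
  | .var i => a ≤ mk R (.var i)
  | .sup s t => UpperHalf a b s ∨ UpperHalf a b t ∨
      (a ≤ mk R (.sup s t) ∧ ¬ mk R (.sup s t) ≤ b)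
  | .inf s t => UpperHalf a b s ∧ UpperHalf a b t

/-! ### Doubling an interval of a presented lattice -/

section Dean

variable {α : Type} {R : Set (Term α × Term α)} {a b : Presented α R}

theorem UpperHalf.le {t : Term α} (h : UpperHalf a b t) : a ≤ mk R t := by
  induction t with
  | var i => exact h
  | sup s t hs ht =>
    rcases h with h | h | h
    · exact (hs h).trans (mk_le_mk_sup_left _ _)
    · exact (ht h).trans (mk_le_mk_sup_right _ _)
    · exact h.1
  | inf s t hs ht => exact _root_.le_inf (hs h.1) (ht h.2)

/-- Only `[a, b]` is doubled, so an element above `a` that has left the interval is automatically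
above the upper copy of `a`. Both parts of a meet inherit the two assumptions. -/
theorem UpperHalf.of_not_le {t : Term α} (h : a ≤ mk R t) (h' : ¬ mk R t ≤ b) :
    UpperHalf a b t := by
  induction t with
  | var i => exact h
  | sup s t hs ht => exact .inr (.inr ⟨h, h'⟩)
  | inf s t hs ht =>
    exact ⟨hs (h.trans (mk_inf_le_left s t)) fun k => h' ((mk_inf_le_left s t).trans k),
      ht (h.trans (mk_inf_le_right s t)) fun k => h' ((mk_inf_le_right s t).trans k)⟩

/-- The lattice laws survive doubling, and a relation could fail only if a side of it had its value
in the doubled interval. In the cases of relations, and of a join that is upper by its own value,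
the larger element is above `a` and not below `b`, so `UpperHalf.of_not_le` applies. -/
theorem UpperHalf.mono
    (hR : ∀ r ∈ R, ∀ u, u = r.1 ∨ u = r.2 → ¬ (a ≤ mk R u ∧ mk R u ≤ b))
    {s t : Term α} (h : TermLE R s t) : UpperHalf a b s → UpperHalf a b t := by
  induction h with
  | refl s => exact id
  | trans _ _ h k => exact fun x => k (h x)
  | inf_left s t => exact fun h => h.1
  | inf_right s t => exact fun h => h.2
  | le_inf _ _ h k => exact fun x => ⟨h x, k x⟩
  | left_sup s t => exact fun h => .inl h
  | right_sup s t => exact fun h => .inr (.inl h)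
  | @sup_le s t u h₁ h₂ h k =>
    rintro (x | x | x)
    · exact h x
    · exact k x
    · have hle : mk R (.sup s t) ≤ mk R u := TermLE.sup_le h₁ h₂
      exact .of_not_le (x.1.trans hle) fun y => x.2 (hle.trans y)
  | @rel_le s t h =>
    intro x
    have hle : mk R s ≤ mk R t := TermLE.rel_le h
    have := hR _ h t (.inr rfl)
    have h1 := x.le.trans hle
    exact .of_not_le h1 fun y => this ⟨h1, y⟩
  | @rel_ge s t h =>
    intro x
    have hle : mk R t ≤ mk R s := TermLE.rel_ge h
    have := hR _ h s (.inl rfl)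
    have h1 := x.le.trans hle
    exact .of_not_le h1 fun y => this ⟨h1, y⟩

end Dean

theorem DeanCondition.mono {D : Type} [Lattice D] {P Q : Set D} (h : DeanCondition P)
    (hPQ : P ⊆ Q) : DeanCondition Q := fun S T hS hT hle =>
  (h S T hS hT hle).imp_right (Or.imp_right fun ⟨p, hp, k⟩ => ⟨p, hPQ hp, k⟩)

/-- **Dean's theorem**: a presented lattice satisfies Dean's condition for the set of the elements
denoted by the two sides of the relations. -/
theorem deanCondition_presented {α : Type} (R : Set (Term α × Term α)) :
    DeanCondition {x : Presented α R | ∃ r ∈ R, x = mk R r.1 ∨ x = mk R r.2} := by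
  classical
  intro S T hS hT hle
  by_contra hcon
  push Not at hcon
  obtain ⟨h1, h2, h3⟩ := hcon
  set a := S.inf' hS id with ha
  set b := T.sup' hT id with hb
  -- Failure of the third alternative says exactly that no side of a relation has its value in `[a,
  -- b]`.
  have hR : ∀ r ∈ R, ∀ u, u = r.1 ∨ u = r.2 → ¬ (a ≤ mk R u ∧ mk R u ≤ b) := by
    rintro r hr u hu ⟨k1, k2⟩
    exact h3 (mk R u) ⟨r, hr, hu.imp (congrArg _) (congrArg _)⟩ k1 k2
  have key : ∀ {s t}, TermLE R s t → UpperHalf a b s → UpperHalf a b t :=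
    fun h => UpperHalf.mono hR h
  -- By `key`, lying in the upper half does not depend on the term chosen for an element.
  let V : Presented α R → Prop := fun x => ∃ t, x = mk R t ∧ UpperHalf a b t
  have hV : ∀ t, V (mk R t) ↔ UpperHalf a b t := by
    refine fun t => ⟨?_, fun h => ⟨t, rfl, h⟩⟩
    rintro ⟨s, hs, h⟩
    exact key (mk_le_mk.1 hs.ge) h
  have hVle : ∀ x, V x → a ≤ x := by
    rintro _ ⟨t, rfl, h⟩; exact h.le
  have hVa : V (S.inf' hS id) := by
    have : ∀ s ∈ S, V s := by
      intro s hs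
      obtain ⟨t, rfl⟩ := mk_surjective s
      exact ⟨t, rfl, .of_not_le (Finset.inf'_le id hs) (h1 _ hs)⟩
    refine Finset.inf'_induction hS id ?_ this
    rintro x hx y hy
    obtain ⟨s, rfl⟩ := mk_surjective x
    obtain ⟨t, rfl⟩ := mk_surjective y
    exact (hV (.inf s t)).2 ⟨(hV s).1 hx, (hV t).1 hy⟩
  -- No member of `T` is above `a`, so none is upper, and a join of non-upper elements that stays
  -- below `b` does not become upper.
  have hVb : ¬ V (T.sup' hT id) ∧ T.sup' hT id ≤ b := by
    refine Finset.sup'_induction hT id (p := fun x => ¬ V x ∧ x ≤ b) ?_ ?_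
    · rintro x ⟨hx, hxb⟩ y ⟨hy, hyb⟩
      refine ⟨?_, sup_le hxb hyb⟩
      obtain ⟨s, rfl⟩ := mk_surjective x
      obtain ⟨t, rfl⟩ := mk_surjective y
      rw [← mk_sup, hV]
      rintro (h | h | h)
      · exact hx ((hV s).2 h)
      · exact hy ((hV t).2 h)
      · exact h.2 (sup_le hxb hyb)
    · exact fun t ht => ⟨fun h => h2 t ht (hVle _ h), Finset.le_sup' id ht⟩
  apply hVb.1
  obtain ⟨s, hs⟩ := mk_surjective a
  obtain ⟨t, ht⟩ := mk_surjective b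
  change V a at hVa
  change V b
  rw [← hs, hV] at hVa
  rw [← ht, hV]
  refine key ?_ hVa
  rw [← mk_le_mk, hs, ht]
  exact hle

/-- **Whitman's condition** in free lattices. -/
theorem whitman (α : Type) : DeanCondition (∅ : Set (FreeLattice α)) :=
  (deanCondition_presented ∅).mono fun _ ⟨_, h, _⟩ => h.elim

/-- The generators of a free lattice are join prime. -/
theorem exists_var_le {α : Type} {i : α} {T : Finset (FreeLattice α)} (hT : T.Nonempty)
    (h : mk ∅ (.var i) ≤ T.sup' hT id) : ∃ t ∈ T, mk ∅ (.var i) ≤ t := by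
  classical
  -- `χ` is the characteristic function of the filter above the generator `i`. Being a homomorphism
  -- to the two-element lattice, it shows that this filter is prime.
  let χ : LatticeHom (FreeLattice α) Prop := freeLift (fun j => j = i)
  have h1 : ∀ x : FreeLattice α, χ x → mk ∅ (.var i) ≤ x := by
    intro x
    obtain ⟨t, rfl⟩ := mk_surjective x
    induction t with
    | var j => rintro (rfl : j = i); exact le_rfl
    | sup s t hs ht =>
      rintro (h | h)
      · exact (hs h).trans (mk_le_mk_sup_left _ _)
      · exact (ht h).trans (mk_le_mk_sup_right _ _)
    | inf s t hs ht => exact fun h => le_inf (hs h.1) (ht h.2)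
  have h2 : χ (T.sup' hT id) := (OrderHomClass.mono χ h : χ _ ≤ χ _) (rfl : i = i)
  have h3 : χ (T.sup' hT id) → ∃ t ∈ T, χ t := by
    refine Finset.sup'_induction hT id (p := fun x => χ x → ∃ t ∈ T, χ t) ?_ ?_
    · intro x hx y hy h
      rw [map_sup] at h
      exact h.elim hx hy
    · exact fun t ht h => ⟨t, ht, h⟩
  obtain ⟨t, ht, h⟩ := h3 h2
  exact ⟨t, ht, h1 t h⟩

/-! ### Lower bounded homomorphisms onto finite lattices -/

/-- One step of the recursion that detects the elements with a least preimage: every nontrivial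
cover of `s` by two elements refines to a cover by elements of `Q`. -/
def CoverStep {S : Type} [Lattice S] (Q : Set S) (s : S) : Prop :=
  ∀ u v, s ≤ u ⊔ v → s ≤ u ∨ s ≤ v ∨
    ∀ z, (∀ c ∈ Q, c ≤ u ∨ c ≤ v → c ≤ z) → s ≤ z

theorem CoverStep.mono {S : Type} [Lattice S] {Q Q' : Set S} (h : Q ⊆ Q') {s : S}
    (hs : CoverStep Q s) : CoverStep Q' s := fun u v huv =>
  (hs u v huv).imp_right (Or.imp_right fun k z hz => k z fun c hc => hz c (h hc))

/-- The least set closed under `CoverStep`. -/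
def good (S : Type) [Lattice S] : Set S := {s | ∀ Q : Set S, (∀ s, CoverStep Q s → s ∈ Q) → s ∈ Q}

theorem good_subset {S : Type} [Lattice S] {Q : Set S} (h : ∀ s, CoverStep Q s → s ∈ Q) :
    good S ⊆ Q := fun _ hs => hs Q h

/-- `CoverStep` is monotone in its set, so the intersection of all closed sets is closed. -/
theorem mem_good {S : Type} [Lattice S] {s : S} (h : CoverStep (good S) s) : s ∈ good S :=
  fun _ hQ => hQ _ (h.mono (good_subset hQ))

/-- The meet of `Z` is the required element. Nonemptiness of `Z` is asked for together with the
bound at each `y`, since in the applications both are obtained for all `y` by induction on terms. -/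
theorem exists_isLeast_of_finite {F S : Type} [Lattice F] [Lattice S] {g : LatticeHom F S} {s : S}
    (Z : Set F) (hfin : Z.Finite) (hZ : ∀ z ∈ Z, s ≤ g z) (hne : ∃ y, s ≤ g y)
    (h : ∀ y, s ≤ g y → Z.Nonempty ∧ ∀ a ∈ lowerBounds Z, a ≤ y) :
    ∃ a, IsLeast {x | s ≤ g x} a := by
  obtain ⟨y, hy⟩ := hne
  have hne : hfin.toFinset.Nonempty := by simpa using (h y hy).1
  refine ⟨hfin.toFinset.inf' hne id, ?_, fun y hy => (h y hy).2 _ fun z hz => ?_⟩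
  · simp only [Set.mem_ofPred_eq, map_finset_inf', Finset.le_inf'_iff]
    intro z hz
    exact hZ z (by simpa using hz)
  · exact Finset.inf'_le id (by simpa using hz)

/-- It suffices that `CoverStep` passes on the existence of least preimages. If `p ⊔ q` reaches `s`
but neither part does, then `p ⊔ q` lies above the least preimages of all `c ∈ Q` below `g p` or `g
q`, and the join of these already reaches `s`. That join depends only on the values `g p` and `g q`,
so finitely many such joins and the generators are enough candidates. -/
theorem exists_isLeast_of_mem_good {n : ℕ} {S : Type} [Lattice S] [Finite S]
    (g : LatticeHom (FreeLattice (Fin n)) S) (hg : Function.Surjective g) {s : S}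
    (hs : s ∈ good S) : ∃ a, IsLeast {x | s ≤ g x} a := by
  classical
  refine good_subset (Q := {s | ∃ a, IsLeast {x | s ≤ g x} a}) (fun s hs => ?_) hs
  set Q : Set S := {s | ∃ a, IsLeast {x | s ≤ g x} a} with hQ
  have hβ : ∀ c : S, ∃ a, c ∈ Q → IsLeast {x | c ≤ g x} a := fun c => by
    by_cases hc : c ∈ Q
    · exact hc.imp fun a ha _ => ha
    · exact (hg c).imp fun a _ h => (hc h).elim
  choose β hβ using hβ
  -- The witness is the join of the least preimages of the `c ∈ Q` below `u` or `v`; it is arbitrary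
  -- when there are none.
  have hz : ∀ u v : S, ∃ z, {c | c ∈ Q ∧ (c ≤ u ∨ c ≤ v)}.Nonempty →
      (∀ c ∈ Q, c ≤ u ∨ c ≤ v → c ≤ g z) ∧
      ∀ y, (∀ c ∈ Q, c ≤ u ∨ c ≤ v → β c ≤ y) → z ≤ y := fun u v => by
    set C := {c | c ∈ Q ∧ (c ≤ u ∨ c ≤ v)} with hC
    by_cases hne : C.Nonempty
    · have hf := C.toFinite
      have hne' : hf.toFinset.Nonempty := by simpa using hne
      refine ⟨hf.toFinset.sup' hne' β, fun _ => ⟨fun c hc hcuv => ?_, fun y hy => ?_⟩⟩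
      · have h1 : c ≤ g (β c) := (hβ c hc).1
        refine h1.trans (OrderHomClass.mono g (Finset.le_sup' β ?_))
        exact hf.mem_toFinset.2 ⟨hc, hcuv⟩
      · refine Finset.sup'_le _ _ fun c hc => ?_
        have hc : c ∈ C := by simpa using hc
        exact hy c hc.1 hc.2
    · exact (hg u).imp fun _ _ h => (hne h).elim
  choose zf hzf using hz
  let Z : Set (FreeLattice (Fin n)) :=
    {z | s ≤ g z} ∩ (Set.range (fun i => mk ∅ (.var i)) ∪ Set.range (fun p : S × S => zf p.1 p.2))
  have hfin : Z.Finite :=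
    ((Set.finite_range _).union (Set.finite_range _)).subset Set.inter_subset_right
  refine exists_isLeast_of_finite Z hfin (fun z hz => hz.1) ((hg s).imp fun _ h => h.ge) ?_
  intro y
  obtain ⟨t, rfl⟩ := mk_surjective y
  induction t with
  | var i =>
    intro h
    have hm : mk ∅ (.var i) ∈ Z := ⟨h, .inl ⟨i, rfl⟩⟩
    exact ⟨⟨_, hm⟩, fun a ha => ha hm⟩
  | inf p q hp hq =>
    intro h
    rw [mk_inf, map_inf] at h
    obtain ⟨h1, h2⟩ := hp (h.trans inf_le_left)
    obtain ⟨h3, h4⟩ := hq (h.trans inf_le_right)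
    exact ⟨h1, fun a ha => le_inf (h2 a ha) (h4 a ha)⟩
  | sup p q hp hq =>
    intro h
    rw [mk_sup, map_sup] at h
    by_cases h1 : s ≤ g (mk ∅ p)
    · exact ⟨(hp h1).1, fun a ha => ((hp h1).2 a ha).trans (mk_le_mk_sup_left _ _)⟩
    by_cases h2 : s ≤ g (mk ∅ q)
    · exact ⟨(hq h2).1, fun a ha => ((hq h2).2 a ha).trans (mk_le_mk_sup_right _ _)⟩
    have h3 := ((hs _ _ h).resolve_left h1).resolve_left h2
    -- If there were no such `c`, every element would be an upper bound of the empty family, and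
    -- `h3` would give `s ≤ g p`.
    have hne : {c | c ∈ Q ∧ (c ≤ g (mk ∅ p) ∨ c ≤ g (mk ∅ q))}.Nonempty := by
      by_contra hne
      refine h1 (h3 _ fun c hc hcuv => ?_)
      exact (hne ⟨c, hc, hcuv⟩).elim
    obtain ⟨h4, h5⟩ := hzf _ _ hne
    have hm : zf (g (mk ∅ p)) (g (mk ∅ q)) ∈ Z := ⟨h3 _ h4, .inr ⟨(_, _), rfl⟩⟩
    refine ⟨⟨_, hm⟩, fun a ha => (ha hm).trans (h5 _ fun c hc hcuv => ?_)⟩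
    rcases hcuv with k | k
    · exact ((hβ c hc).2 k).trans (mk_le_mk_sup_left _ _)
    · exact ((hβ c hc).2 k).trans (mk_le_mk_sup_right _ _)

/-- If a term lies below the join of every system of preimages of the members of `U`, then it
is covered by subterms each of which lies below all preimages of some member of `U`. -/
theorem exists_refining_subterms {α S : Type} [Lattice S] (g : LatticeHom (FreeLattice α) S)
    (hg : Function.Surjective g) (U : Finset S) (hU : U.Nonempty) (t : Term α)
    (h : ∀ σ : S → FreeLattice α, (∀ u, g (σ u) = u) → mk ∅ t ≤ U.sup' hU σ) :
    ∃ W : Set (Term α),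
      (∀ w ∈ W, (w = t ∨ sizeOf w < sizeOf t) ∧ ∃ u ∈ U, ∀ y, g y = u → mk ∅ w ≤ y) ∧
      ∀ z, (∀ w ∈ W, g (mk ∅ w) ≤ z) → g (mk ∅ t) ≤ z := by
  classical
  obtain ⟨σ₀, hσ₀⟩ := hg.hasRightInverse
  have hsup : ∀ σ : S → FreeLattice α,
      (U.image σ).sup' (hU.image σ) id = U.sup' hU σ := fun σ => by
    rw [Finset.sup'_image]; rfl
  -- Preimages of different members of `U` are chosen independently, so one section avoids `t` at
  -- all of them.
  have hsec : ∀ t : Term α, (¬ ∃ u ∈ U, ∀ y, g y = u → mk ∅ t ≤ y) →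
      ∃ σ : S → FreeLattice α, (∀ u, g (σ u) = u) ∧ ∀ u ∈ U, ¬ mk ∅ t ≤ σ u := by
    intro t ht
    push Not at ht
    have : ∀ u, ∃ y, g y = u ∧ (u ∈ U → ¬ mk ∅ t ≤ y) := fun u => by
      by_cases hu : u ∈ U
      · exact (ht u hu).imp fun y hy => ⟨hy.1, fun _ => hy.2⟩
      · exact ⟨σ₀ u, hσ₀ u, fun h => (hu h).elim⟩
    choose σ h1 h2 using this
    exact ⟨σ, h1, h2⟩
  induction t with
  | var i =>
    by_cases htriv : ∃ u ∈ U, ∀ y, g y = u → mk ∅ (.var i) ≤ y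
    · refine ⟨{.var i}, ?_, fun z hz => hz _ rfl⟩
      rintro w rfl
      exact ⟨.inl rfl, htriv⟩
    obtain ⟨σ₁, hσ₁, hn₁⟩ := hsec _ htriv
    have h1 := h σ₁ hσ₁
    rw [← hsup] at h1
    obtain ⟨x, hx, h2⟩ := exists_var_le _ h1
    obtain ⟨u, hu, rfl⟩ := Finset.mem_image.1 hx
    exact (hn₁ u hu h2).elim
  | sup p q hp hq =>
    obtain ⟨W₁, hW₁, hz₁⟩ := hp fun σ hσ => (mk_le_mk_sup_left p q).trans (h σ hσ)
    obtain ⟨W₂, hW₂, hz₂⟩ := hq fun σ hσ => (mk_le_mk_sup_right p q).trans (h σ hσ)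
    refine ⟨W₁ ∪ W₂, ?_, fun z hz => ?_⟩
    · rintro w (hw | hw)
      · refine ⟨.inr ?_, (hW₁ w hw).2⟩
        rcases (hW₁ w hw).1 with rfl | h' <;> simp only [Term.sup.sizeOf_spec] <;> omega
      · refine ⟨.inr ?_, (hW₂ w hw).2⟩
        rcases (hW₂ w hw).1 with rfl | h' <;> simp only [Term.sup.sizeOf_spec] <;> omega
    · rw [mk_sup, map_sup]
      exact sup_le (hz₁ z fun w hw => hz w (.inl hw)) (hz₂ z fun w hw => hz w (.inr hw))
  | inf p q hp hq =>
    by_cases htriv : ∃ u ∈ U, ∀ y, g y = u → mk ∅ (.inf p q) ≤ y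
    · refine ⟨{.inf p q}, ?_, fun z hz => hz _ rfl⟩
      rintro w rfl
      exact ⟨.inl rfl, htriv⟩
    by_cases hpa : ∀ σ : S → FreeLattice α, (∀ u, g (σ u) = u) → mk ∅ p ≤ U.sup' hU σ
    · obtain ⟨W, hW, hz⟩ := hp hpa
      refine ⟨W, fun w hw => ⟨.inr ?_, (hW w hw).2⟩, fun z h => le_trans ?_ (hz z h)⟩
      · rcases (hW w hw).1 with rfl | h' <;> simp only [Term.inf.sizeOf_spec] <;> omega
      · exact OrderHomClass.mono g (mk_inf_le_left p q)
    by_cases hqa : ∀ σ : S → FreeLattice α, (∀ u, g (σ u) = u) → mk ∅ q ≤ U.sup' hU σ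
    · obtain ⟨W, hW, hz⟩ := hq hqa
      refine ⟨W, fun w hw => ⟨.inr ?_, (hW w hw).2⟩, fun z h => le_trans ?_ (hz z h)⟩
      · rcases (hW w hw).1 with rfl | h' <;> simp only [Term.inf.sizeOf_spec] <;> omega
      · exact OrderHomClass.mono g (mk_inf_le_right p q)
    exfalso
    push Not at hpa hqa
    obtain ⟨σ₁, hσ₁, hn₁⟩ := hsec _ htriv
    obtain ⟨σ₂, hσ₂, hn₂⟩ := hpa
    obtain ⟨σ₃, hσ₃, hn₃⟩ := hqa
    -- A pointwise meet of sections is a section. This one lies below all three witnesses, and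
    -- therefore defeats every alternative of Whitman's condition at once.
    let σ : S → FreeLattice α := fun u => σ₁ u ⊓ (σ₂ u ⊓ σ₃ u)
    have hσ : ∀ u, g (σ u) = u := fun u => by simp [σ, hσ₁, hσ₂, hσ₃]
    have h12 : U.sup' hU σ ≤ U.sup' hU σ₂ :=
      Finset.sup'_mono_fun fun u _ => inf_le_right.trans inf_le_left
    have h13 : U.sup' hU σ ≤ U.sup' hU σ₃ :=
      Finset.sup'_mono_fun fun u _ => inf_le_right.trans inf_le_right
    have hS : ({mk ∅ p, mk ∅ q} : Finset (FreeLattice α)).Nonempty := by simp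
    have hinf : ({mk ∅ p, mk ∅ q} : Finset (FreeLattice α)).inf' hS id = mk ∅ (.inf p q) := by
      simp [mk_inf]
    rcases whitman α {mk ∅ p, mk ∅ q} (U.image σ) hS (hU.image σ)
      (by rw [hsup, hinf]; exact h σ hσ) with ⟨x, hx, hle⟩ | ⟨x, hx, hle⟩ | ⟨x, hx, -⟩
    · rw [hsup] at hle
      rcases Finset.mem_insert.1 hx with rfl | hx
      · exact hn₂ (hle.trans h12)
      · rw [Finset.mem_singleton.1 hx] at hle
        exact hn₃ (hle.trans h13)
    · obtain ⟨u, hu, rfl⟩ := Finset.mem_image.1 hx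
      rw [hinf] at hle
      exact hn₁ u hu (hle.trans inf_le_left)
    · exact hx

/-- Induction on the size of a term `t` for the least preimage. Suppose that a cover `u`, `v` of `s`
violates `CoverStep`, with `z` above all good elements below `u` or `v`. In a cover that cannot be
refined further, every maximal element has a least preimage denoted by `t` or by a smaller term. The
term `t` itself would put `s` below `u` or `v`; a smaller term makes the element good, hence below
`z`. So the whole cover, and with it `s`, would lie below `z`. -/
theorem mem_good_of_isLeast {α S : Type} [Lattice S] [Finite S] (g : LatticeHom (FreeLattice α) S)
    (hg : Function.Surjective g) {s : S} {a : FreeLattice α} (h : IsLeast {x | s ≤ g x} a) :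
    s ∈ good S := by
  classical
  obtain ⟨t, rfl⟩ := mk_surjective a
  induction hN : sizeOf t using Nat.strong_induction_on generalizing s t with
  | _ N ih =>
  subst hN
  refine mem_good fun u v huv => ?_
  by_contra hcon
  push Not at hcon
  obtain ⟨hu, hv, z, hz, hsz⟩ := hcon
  -- Covers are represented by the lower sets they generate, so that refinement becomes inclusion
  -- and finiteness gives a minimal one.
  let F : Set (Set S) := {I | I ⊆ {c | c ≤ u ∨ c ≤ v} ∧ IsLowerSet I ∧
    ∀ z, (∀ c ∈ I, c ≤ z) → s ≤ z}
  have hF : {c | c ≤ u ∨ c ≤ v} ∈ F := by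
    refine ⟨subset_rfl, fun a b hba ha => ?_, fun z hz => huv.trans (sup_le ?_ ?_)⟩
    · exact Or.imp hba.trans hba.trans ha
    · exact hz u (.inl le_rfl)
    · exact hz v (.inr le_rfl)
  obtain ⟨I, hI⟩ := (Set.toFinite F).exists_minimal ⟨_, hF⟩
  obtain ⟨hIuv, hIlow, hIs⟩ := hI.prop
  have hIne : I.Nonempty := by
    by_contra hne
    rw [Set.not_nonempty_iff_eq_empty] at hne
    exact hu (hIs u fun c hc => by simp [hne] at hc)
  have hIf := I.toFinite
  -- Arbitrary preimages of the members of `I` join to an element whose image is above `s`, so this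
  -- join is above the least preimage.
  obtain ⟨W, hW, hWt⟩ := exists_refining_subterms g hg hIf.toFinset (by simpa using hIne) t
    (fun σ hσ => h.2 (hIs _ fun c hc => by
      conv_lhs => rw [← hσ c]
      exact OrderHomClass.mono g (Finset.le_sup' σ (by simpa using hc))))
  have hWI : ∀ w ∈ W, g (mk ∅ w) ∈ I := by
    intro w hw
    obtain ⟨-, c, hc, hcy⟩ := hW w hw
    obtain ⟨y, rfl⟩ := hg c
    exact hIlow (OrderHomClass.mono g (hcy y rfl)) (by simpa using hc)
  have hJ : {c | ∃ w ∈ W, c ≤ g (mk ∅ w)} ∈ F := by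
    refine ⟨fun c ⟨w, hw, hc⟩ => hIuv (hIlow hc (hWI w hw)),
      fun a b hba ⟨w, hw, ha⟩ => ⟨w, hw, hba.trans ha⟩, fun z hz => ?_⟩
    exact le_trans h.1 (hWt z fun w hw => hz _ ⟨w, hw, le_rfl⟩)
  have hIJ := hI.le_of_le hJ fun c ⟨w, hw, hc⟩ => hIlow hc (hWI w hw)
  have hc : ∃ c ∈ I, ¬ c ≤ z := by
    by_contra hc
    push Not at hc
    exact hsz (hIs z hc)
  obtain ⟨c, hcI, hcz⟩ := hc
  obtain ⟨m, hcm, hm⟩ := hIf.exists_le_maximal hcI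
  obtain ⟨w, hw, hmw⟩ := hIJ hm.prop
  obtain ⟨hwt, c', hc', hy⟩ := hW w hw
  have hc' : c' ∈ I := by simpa using hc'
  have hmw : m = g (mk ∅ w) := hm.eq_of_le (hWI w hw) hmw
  have hwc' : g (mk ∅ w) ≤ c' := by
    obtain ⟨y, rfl⟩ := hg c'
    exact OrderHomClass.mono g (hy y rfl)
  have hmc : m = c' := hm.eq_of_le hc' (hmw.le.trans hwc')
  -- For `m ≤ g x`, the meet of `w` with `x` is again a preimage of `m = c'`, and `w` lies below all
  -- of these.
  have hleast : IsLeast {x | m ≤ g x} (mk ∅ w) := by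
    refine ⟨hmw.le, fun x hx => ?_⟩
    have hx : m ≤ g x := hx
    refine (hy (mk ∅ w ⊓ x) ?_).trans inf_le_right
    rw [map_inf, ← hmw, ← hmc]
    exact inf_eq_left.2 hx
  rcases hwt with rfl | hwt
  · have h1 : s ≤ m := hmw ▸ h.1
    rcases hIuv hm.prop with k | k
    · exact hu (h1.trans k)
    · exact hv (h1.trans k)
  · exact hcz (hcm.trans (hz m (ih _ hwt w hleast rfl) (hIuv hm.prop)))

/-! ### Lower bounded lattices with Dean's condition -/

/-- Least preimages of two elements join to the least preimage of their join. For a meet, Dean's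
condition says that a join above `d₁ ⊓ d₂` is above `d₁` or `d₂`, or has a joinand above `d₁ ⊓ d₂`,
or is above some `p ∈ X` with `d₁ ⊓ d₂ ≤ p`. So the candidates are the least preimages of `d₁`, of
`d₂` and of these finitely many `p`. -/
theorem exists_isLeast_of_dean {α D : Type} [Lattice D] {X : Set D} (hX : X.Finite)
    (hD : DeanCondition X) (h : LatticeHom (FreeLattice α) D) (hs : Function.Surjective h)
    (hgen : ∀ i, h (mk ∅ (.var i)) ∈ X) (hβ : ∀ p ∈ X, ∃ a, IsLeast {x | p ≤ h x} a) (d : D) :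
    ∃ a, IsLeast {x | d ≤ h x} a := by
  classical
  obtain ⟨x, rfl⟩ := hs d
  obtain ⟨t, rfl⟩ := mk_surjective x
  induction t with
  | var i => exact hβ _ (hgen i)
  | sup p q hp hq =>
    obtain ⟨a, ha⟩ := hp
    obtain ⟨b, hb⟩ := hq
    refine ⟨a ⊔ b, ?_, fun y hy => ?_⟩
    · have h1 := ha.1
      have h2 := hb.1
      simp only [Set.mem_ofPred_eq, mk_sup, map_sup] at h1 h2 ⊢
      exact sup_le_sup h1 h2
    · simp only [Set.mem_ofPred_eq, mk_sup, map_sup] at hy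
      exact sup_le (ha.2 (le_sup_left.trans hy)) (hb.2 (le_sup_right.trans hy))
  | inf p q hp hq =>
    obtain ⟨a, ha⟩ := hp
    obtain ⟨b, hb⟩ := hq
    have : Nonempty (FreeLattice α) := ⟨a⟩
    choose! β hβ using hβ
    rw [mk_inf, map_inf]
    set d₁ := h (mk ∅ p)
    set d₂ := h (mk ∅ q)
    let Z : Set (FreeLattice α) := {a, b} ∪ β '' {p | p ∈ X ∧ d₁ ⊓ d₂ ≤ p}
    have haZ : a ∈ Z := .inl (.inl rfl)
    have hbZ : b ∈ Z := .inl (.inr rfl)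
    have hpZ : ∀ p ∈ X, d₁ ⊓ d₂ ≤ p → β p ∈ Z := fun p h1 h2 => .inr ⟨p, ⟨h1, h2⟩, rfl⟩
    refine exists_isLeast_of_finite Z ?_ ?_ (hs _ |>.imp fun _ h => h.ge) fun y => ?_
    · exact (Set.toFinite _).union ((hX.subset fun _ h => h.1).image _)
    · rintro z ((rfl | rfl) | ⟨p, ⟨h1, h2⟩, rfl⟩)
      · exact inf_le_left.trans ha.1
      · exact inf_le_right.trans hb.1
      · exact h2.trans (hβ p h1).1
    · obtain ⟨r, rfl⟩ := mk_surjective y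
      refine fun hr => ⟨⟨a, haZ⟩, fun e he => ?_⟩
      induction r with
      | var i => exact (he (hpZ _ (hgen i) hr)).trans ((hβ _ (hgen i)).2 le_rfl)
      | inf r₁ r₂ h₁ h₂ =>
        rw [mk_inf, map_inf] at hr
        exact le_inf (h₁ (hr.trans inf_le_left)) (h₂ (hr.trans inf_le_right))
      | sup r₁ r₂ h₁ h₂ =>
        rw [mk_sup, map_sup] at hr
        rcases hD {d₁, d₂} {h (mk ∅ r₁), h (mk ∅ r₂)} (by simp) (by simp) (by simpa using hr)
          with ⟨s, hs, hle⟩ | ⟨s, hs, hle⟩ | ⟨s, hs, hle, hle'⟩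
        · simp only [Finset.mem_insert, Finset.mem_singleton] at hs
          have hle : s ≤ h (mk ∅ (.sup r₁ r₂)) := by simpa [mk_sup] using hle
          rcases hs with rfl | rfl
          · exact (he haZ).trans (ha.2 hle)
          · exact (he hbZ).trans (hb.2 hle)
        · simp only [Finset.mem_insert, Finset.mem_singleton] at hs
          have hle : d₁ ⊓ d₂ ≤ s := by simpa using hle
          rcases hs with rfl | rfl
          · exact (h₁ hle).trans (mk_le_mk_sup_left _ _)
          · exact (h₂ hle).trans (mk_le_mk_sup_right _ _)
        · have hle : d₁ ⊓ d₂ ≤ s := by simpa using hle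
          have hle' : s ≤ h (mk ∅ (.sup r₁ r₂)) := by simpa [mk_sup] using hle'
          exact (he (hpZ s hs hle)).trans ((hβ s hs).2 hle')

theorem mem_generated {L : Type} [Lattice L] {X : Set L} {x : L} :
    x ∈ generated X ↔ ∀ M : Sublattice L, X ⊆ M → x ∈ M := by
  simp [generated, Sublattice.mem_sInf]

theorem subset_generated {L : Type} [Lattice L] (X : Set L) : X ⊆ generated X :=
  fun _ hx => mem_generated.2 fun _ hM => hM hx

/-- The elements of a sublattice generated by a family are the values of the terms. -/
theorem mem_generated_range {α L : Type} [Lattice L] (x : α → L) {y : L} :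
    y ∈ generated (Set.range x) ↔ ∃ t : Term α, t.eval x = y := by
  constructor
  · intro h
    let M : Sublattice L :=
      { carrier := {y | ∃ t : Term α, t.eval x = y}
        supClosed' := by rintro _ ⟨s, rfl⟩ _ ⟨t, rfl⟩; exact ⟨.sup s t, rfl⟩
        infClosed' := by rintro _ ⟨s, rfl⟩ _ ⟨t, rfl⟩; exact ⟨.inf s t, rfl⟩ }
    refine mem_generated.1 h M ?_
    rintro _ ⟨i, rfl⟩
    exact ⟨.var i, rfl⟩
  · rintro ⟨t, rfl⟩
    induction t with
    | var i => exact subset_generated _ ⟨i, rfl⟩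
    | sup s t hs ht => exact (generated _).sup_mem hs ht
    | inf s t hs ht => exact (generated _).inf_mem hs ht

/-- A lattice that satisfies Dean's condition for a finite generating set `X` is lower
bounded if and only if `φ` maps `X` to good elements, where `φ` is a homomorphism onto a finite
lattice that preserves and reflects the inequalities `p ≤ d` with `p ∈ X`. -/
theorem isLowerBoundedLattice_iff {D S : Type} [Lattice D] [Lattice S] [Finite S] {n : ℕ}
    (x : Fin n → D) (hgen : ∀ d, ∃ t : Term (Fin n), t.eval x = d)
    (hD : DeanCondition (Set.range x)) (φ : LatticeHom D S) (hφ : Function.Surjective φ)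
    (hx : ∀ i d, φ (x i) ≤ φ d → x i ≤ d) :
    IsLowerBoundedLattice D ↔ ∀ i, φ (x i) ∈ good S := by
  have hx' : ∀ i d, φ (x i) ≤ φ d ↔ x i ≤ d := fun i d => ⟨hx i d, fun h => OrderHomClass.mono φ h⟩
  constructor
  · rintro ⟨m, f, hf, hlb⟩ i
    obtain ⟨y, hy⟩ := hf (x i)
    rcases hlb (x i) with h | ⟨a, ha⟩
    · exact (h.subset (show y ∈ {z | x i ≤ f z} from hy.ge)).elim
    -- As `φ` preserves and reflects the inequalities `x i ≤ d`, the sets of preimages to be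
    -- minimised for `f` and for `φ.comp f` coincide. The converse direction uses the same equality.
    · refine mem_good_of_isLeast (φ.comp f) (hφ.comp hf) (a := a) ?_
      simpa [hx'] using ha
  · intro h
    have hsurj : Function.Surjective (freeLift x) := fun d => by
      obtain ⟨t, rfl⟩ := hgen d
      exact ⟨mk ∅ t, rfl⟩
    refine ⟨n, freeLift x, hsurj, fun d => .inr ?_⟩
    refine exists_isLeast_of_dean (Set.finite_range x) hD (freeLift x) hsurj
      (fun i => ⟨i, rfl⟩) ?_ d
    rintro _ ⟨i, rfl⟩
    obtain ⟨a, ha⟩ := exists_isLeast_of_mem_good (φ.comp (freeLift x)) (hφ.comp hsurj) (h i)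
    exact ⟨a, by simpa [hx'] using ha⟩

/-- The image of a lattice homomorphism. -/
def homRange {A B : Type} [Lattice A] [Lattice B] (f : LatticeHom A B) : Sublattice B where
  carrier := Set.range f
  supClosed' := by rintro _ ⟨a, rfl⟩ _ ⟨b, rfl⟩; exact ⟨a ⊔ b, map_sup f a b⟩
  infClosed' := by rintro _ ⟨a, rfl⟩ _ ⟨b, rfl⟩; exact ⟨a ⊓ b, map_inf f a b⟩

/-- A lattice homomorphism as a map onto its image. -/
def rangeHom {A B : Type} [Lattice A] [Lattice B] (f : LatticeHom A B) :
    LatticeHom A (homRange f) where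
  toFun a := ⟨f a, a, rfl⟩
  map_sup' a b := Subtype.ext (map_sup f a b)
  map_inf' a b := Subtype.ext (map_inf f a b)

theorem rangeHom_surjective {A B : Type} [Lattice A] [Lattice B] (f : LatticeHom A B) :
    Function.Surjective (rangeHom f) := by
  rintro ⟨_, a, rfl⟩
  exact ⟨a, rfl⟩

/-! ### The finite lattice of ideals of a set of terms -/

/-- `E` is a relation on the set `T` of terms that satisfies the rules of `TermLE R`, as far
as they concern members of `T`. -/
structure Saturated {α : Type} (R : Set (Term α × Term α)) (T : Set (Term α))
    (E : Term α → Term α → Prop) : Prop where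
  var_mem : ∀ i, Term.var i ∈ T
  of_sup : ∀ {s t}, Term.sup s t ∈ T → s ∈ T ∧ t ∈ T
  of_inf : ∀ {s t}, Term.inf s t ∈ T → s ∈ T ∧ t ∈ T
  rel_mem : ∀ r ∈ R, r.1 ∈ T ∧ r.2 ∈ T
  refl : ∀ s ∈ T, E s s
  trans : ∀ s ∈ T, ∀ t ∈ T, ∀ u ∈ T, E s t → E t u → E s u
  inf_left : ∀ {s t}, Term.inf s t ∈ T → E (.inf s t) s
  inf_right : ∀ {s t}, Term.inf s t ∈ T → E (.inf s t) t
  le_inf : ∀ {s t}, ∀ u ∈ T, Term.inf s t ∈ T → E u s → E u t → E u (.inf s t)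
  left_sup : ∀ {s t}, Term.sup s t ∈ T → E s (.sup s t)
  right_sup : ∀ {s t}, Term.sup s t ∈ T → E t (.sup s t)
  sup_le : ∀ {s t}, ∀ u ∈ T, Term.sup s t ∈ T → E s u → E t u → E (.sup s t) u
  rel_le : ∀ r ∈ R, E r.1 r.2
  rel_ge : ∀ r ∈ R, E r.2 r.1

/-- The subsets of `T` that are closed downwards and under the joins that belong to `T`. -/
structure IsTermIdeal {α : Type} (T : Set (Term α)) (E : Term α → Term α → Prop)
    (I : Set (Term α)) : Prop where
  subset : I ⊆ T
  mem_of_le : ∀ q ∈ I, ∀ p ∈ T, E p q → p ∈ I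
  sup_mem : ∀ a ∈ I, ∀ b ∈ I, Term.sup a b ∈ T → Term.sup a b ∈ I

/-- The lattice of ideals of a set of terms. -/
def TermIdeal {α : Type} (T : Set (Term α)) (E : Term α → Term α → Prop) : Type :=
  {I : Set (Term α) // IsTermIdeal T E I}

namespace TermIdeal

variable {α : Type} {T : Set (Term α)} {E : Term α → Term α → Prop}

instance : PartialOrder (TermIdeal T E) := Subtype.partialOrder _

instance : Lattice (TermIdeal T E) where
  inf I J := ⟨I.1 ∩ J.1, fun _ h => I.2.subset h.1,
    fun q hq p hp h => ⟨I.2.mem_of_le q hq.1 p hp h, J.2.mem_of_le q hq.2 p hp h⟩,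
    fun a ha b hb h => ⟨I.2.sup_mem a ha.1 b hb.1 h, J.2.sup_mem a ha.2 b hb.2 h⟩⟩
  inf_le_left _ _ := Set.inter_subset_left
  inf_le_right _ _ := Set.inter_subset_right
  le_inf _ _ _ h k := Set.subset_inter h k
  -- The join is the intersection of the ideals containing both. The explicit `t ∈ T` yields
  -- containment in `T` without exhibiting such an ideal.
  sup I J := ⟨{t | t ∈ T ∧ ∀ K : TermIdeal T E, I ≤ K → J ≤ K → t ∈ K.1}, fun _ h => h.1,
    fun q hq p hp h => ⟨hp, fun K hI hJ => K.2.mem_of_le q (hq.2 K hI hJ) p hp h⟩,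
    fun a ha b hb h => ⟨h, fun K hI hJ => K.2.sup_mem a (ha.2 K hI hJ) b (hb.2 K hI hJ) h⟩⟩
  le_sup_left I _ := fun _ ht => ⟨I.2.subset ht, fun _ hI _ => hI ht⟩
  le_sup_right _ J := fun _ ht => ⟨J.2.subset ht, fun _ _ hJ => hJ ht⟩
  sup_le _ _ K hI hJ := fun _ ht => ht.2 K hI hJ

theorem mem_inf {I J : TermIdeal T E} {t : Term α} : t ∈ (I ⊓ J).1 ↔ t ∈ I.1 ∧ t ∈ J.1 := Iff.rfl

theorem finite (hT : T.Finite) : Finite (TermIdeal T E) := by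
  have : Finite {I : Set (Term α) | I ⊆ T} := hT.finite_subsets
  exact Finite.of_injective (β := {I : Set (Term α) | I ⊆ T}) (fun I => ⟨I.1, I.2.subset⟩)
    fun I J h => Subtype.ext (congrArg (fun K : {I : Set (Term α) | I ⊆ T} => K.1) h)

variable {R : Set (Term α × Term α)}

/-- The principal ideal of a member of `T`. -/
def principal (h : Saturated R T E) (p : Term α) (hp : p ∈ T) : TermIdeal T E :=
  ⟨{q | q ∈ T ∧ E q p}, fun _ hq => hq.1,
    fun q hq r hr hrq => ⟨hr, h.trans r hr q hq.1 p hp hrq hq.2⟩,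
    fun _ ha _ hb hab => ⟨hab, h.sup_le p hp hab ha.2 hb.2⟩⟩

theorem principal_le {h : Saturated R T E} {p : Term α} {hp : p ∈ T} {I : TermIdeal T E} :
    principal h p hp ≤ I ↔ p ∈ I.1 :=
  ⟨fun hI => hI ⟨hp, h.refl p hp⟩, fun hI q hq => I.2.mem_of_le p hI q hq.1 hq.2⟩

/-- The rules of `Saturated` are those needed here: closure of ideals under joins in `T` handles
joins, and `le_inf` handles meets. It follows that the principal ideals of the variables satisfy the
relations. -/
theorem eval_principal (h : Saturated R T E) (t : Term α) (ht : t ∈ T) :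
    t.eval (fun i => principal h (.var i) (h.var_mem i)) = principal h t ht := by
  induction t with
  | var i => rfl
  | sup s t hs ht' =>
    obtain ⟨h1, h2⟩ := h.of_sup ht
    rw [Term.eval, hs h1, ht' h2]
    refine le_antisymm (sup_le ?_ ?_) (principal_le.2 ?_)
    · exact principal_le.2 ⟨h1, h.left_sup ht⟩
    · exact principal_le.2 ⟨h2, h.right_sup ht⟩
    · exact (_ ⊔ _ : TermIdeal T E).2.sup_mem s (principal_le.1 le_sup_left)
        t (principal_le.1 le_sup_right) ht
  | inf s t hs ht' =>
    obtain ⟨h1, h2⟩ := h.of_inf ht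
    rw [Term.eval, hs h1, ht' h2]
    refine le_antisymm (fun q hq => ?_) (le_inf ?_ ?_)
    · exact ⟨hq.1.1, h.le_inf q hq.1.1 ht hq.1.2 hq.2.2⟩
    · exact principal_le.2 ⟨ht, h.inf_left ht⟩
    · exact principal_le.2 ⟨ht, h.inf_right ht⟩

/-- The homomorphism of the presented lattice to the lattice of ideals. -/
def hom (h : Saturated R T E) : LatticeHom (Presented α R) (TermIdeal T E) :=
  Presented.lift (fun i => principal h (.var i) (h.var_mem i)) fun r hr => by
    obtain ⟨h1, h2⟩ := h.rel_mem r hr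
    rw [eval_principal h _ h1, eval_principal h _ h2]
    exact le_antisymm (principal_le.2 ⟨h1, h.rel_le r hr⟩) (principal_le.2 ⟨h2, h.rel_ge r hr⟩)

theorem hom_mk (h : Saturated R T E) {p : Term α} (hp : p ∈ T) :
    hom h (mk R p) = principal h p hp := eval_principal h p hp

/-- Only consequences of the relations enter `hom h d`. In the join case, the members of `T` below
`d` form an ideal that contains both parts, hence also their join. The bound `d` is kept general in
the induction so that both parts are compared with the same element. -/
theorem mem_hom (h : Saturated R T E) (hE : ∀ p ∈ T, ∀ q ∈ T, E p q → TermLE R p q) {p : Term α}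
    {d : Presented α R} : p ∈ (hom h d).1 ↔ p ∈ T ∧ mk R p ≤ d := by
  constructor
  · intro hp
    have hpT := (hom h d).2.subset hp
    refine ⟨hpT, ?_⟩
    have : ∀ (t : Term α) (d : Presented α R), mk R t ≤ d →
        ∀ q ∈ (hom h (mk R t)).1, mk R q ≤ d := by
      intro t
      induction t with
      | var i =>
        intro d hd q hq
        rw [hom_mk h (h.var_mem i)] at hq
        exact (mk_le_mk.2 (hE q hq.1 _ (h.var_mem i) hq.2)).trans hd
      | sup s t hs ht =>
        intro d hd q hq
        rw [mk_sup, map_sup] at hq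
        let J : TermIdeal T E := ⟨{q | q ∈ T ∧ mk R q ≤ d}, fun _ h => h.1,
          fun q hq p hp k => ⟨hp, (mk_le_mk.2 (hE p hp q hq.1 k)).trans hq.2⟩,
          fun a ha b hb k => ⟨k, sup_le ha.2 hb.2⟩⟩
        exact (hq.2 J
          (fun r hr => ⟨(hom h _).2.subset hr, hs d ((mk_le_mk_sup_left s t).trans hd) r hr⟩)
          fun r hr => ⟨(hom h _).2.subset hr, ht d ((mk_le_mk_sup_right s t).trans hd) r hr⟩).2
      | inf s t hs ht =>
        intro d hd q hq
        rw [mk_inf, map_inf] at hq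
        exact (le_inf (hs _ le_rfl q hq.1) (ht _ le_rfl q hq.2)).trans hd
    obtain ⟨t, rfl⟩ := mk_surjective d
    exact this t _ le_rfl p hp
  · rintro ⟨hp, hpd⟩
    have := OrderHomClass.mono (hom h) hpd
    rw [hom_mk h hp] at this
    exact principal_le.1 this

/-- On `T`, a saturated relation below `TermLE R` agrees with `TermLE R`. -/
theorem rel_of_termLE (h : Saturated R T E) (hE : ∀ p ∈ T, ∀ q ∈ T, E p q → TermLE R p q)
    {p q : Term α} (hp : p ∈ T) (hq : q ∈ T) (hpq : TermLE R p q) : E p q := by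
  have := (mem_hom h hE (d := mk R q)).2 ⟨hp, hpq⟩
  rw [hom_mk h hq] at this
  exact this.2

end TermIdeal

/-! ### Subterms and the closure of a set of terms -/

theorem Term.self_mem_subterms {α : Type} (t : Term α) : t ∈ t.subterms := by
  cases t <;> simp [Term.subterms]

theorem Term.subterms_finite {α : Type} (t : Term α) : t.subterms.Finite := by
  induction t with
  | var i => exact Set.finite_singleton _
  | sup s t hs ht => exact (Set.finite_singleton _).union (hs.union ht)
  | inf s t hs ht => exact (Set.finite_singleton _).union (hs.union ht)

theorem Term.subterms_trans {α : Type} {s t u : Term α} (h : t ∈ u.subterms)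
    (hs : s ∈ t.subterms) : s ∈ u.subterms := by
  induction u with
  | var i =>
    obtain rfl : t = .var i := h
    exact hs
  | sup p q hp hq =>
    rcases h with h | h | h
    · obtain rfl : t = .sup p q := h
      exact hs
    · exact .inr (.inl (hp h))
    · exact .inr (.inr (hq h))
  | inf p q hp hq =>
    rcases h with h | h | h
    · obtain rfl : t = .inf p q := h
      exact hs
    · exact .inr (.inl (hp h))
    · exact .inr (.inr (hq h))

/-- The variables and the subterms of the members of `U`. -/
def termClosure {α : Type} (U : Set (Term α)) : Set (Term α) :=
  Set.range Term.var ∪ {t | ∃ u ∈ U, t ∈ u.subterms}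

theorem termClosure_finite {α : Type} [Finite α] {U : Set (Term α)} (hU : U.Finite) :
    (termClosure U).Finite := by
  refine (Set.finite_range _).union ?_
  refine (hU.biUnion fun u _ => u.subterms_finite).subset ?_
  rintro t ⟨u, hu, ht⟩
  exact Set.mem_biUnion hu ht

theorem mem_termClosure_of_subterm {α : Type} {U : Set (Term α)} {s t : Term α}
    (ht : t ∈ termClosure U) (hs : s ∈ t.subterms) : s ∈ termClosure U := by
  rcases ht with ⟨i, rfl⟩ | ⟨u, hu, ht⟩
  · obtain rfl : s = .var i := hs
    exact .inl ⟨i, rfl⟩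
  · exact .inr ⟨u, hu, Term.subterms_trans ht hs⟩

theorem subset_termClosure {α : Type} (U : Set (Term α)) : U ⊆ termClosure U :=
  fun u hu => .inr ⟨u, hu, u.self_mem_subterms⟩

theorem of_sup_mem_termClosure {α : Type} {U : Set (Term α)} {s t : Term α}
    (h : Term.sup s t ∈ termClosure U) : s ∈ termClosure U ∧ t ∈ termClosure U :=
  ⟨mem_termClosure_of_subterm h (.inr (.inl s.self_mem_subterms)),
    mem_termClosure_of_subterm h (.inr (.inr t.self_mem_subterms))⟩

theorem of_inf_mem_termClosure {α : Type} {U : Set (Term α)} {s t : Term α}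
    (h : Term.inf s t ∈ termClosure U) : s ∈ termClosure U ∧ t ∈ termClosure U :=
  ⟨mem_termClosure_of_subterm h (.inr (.inl s.self_mem_subterms)),
    mem_termClosure_of_subterm h (.inr (.inr t.self_mem_subterms))⟩

theorem saturated_termLE {α : Type} {R : Set (Term α × Term α)} {U : Set (Term α)}
    (hU : ∀ r ∈ R, r.1 ∈ U ∧ r.2 ∈ U) : Saturated R (termClosure U) (TermLE R) where
  var_mem i := .inl ⟨i, rfl⟩
  of_sup := of_sup_mem_termClosure
  of_inf := of_inf_mem_termClosure
  rel_mem r hr := ⟨subset_termClosure U (hU r hr).1, subset_termClosure U (hU r hr).2⟩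
  refl s _ := .refl s
  trans _ _ _ _ _ _ h k := h.trans k
  inf_left _ := .inf_left _ _
  inf_right _ := .inf_right _ _
  le_inf _ _ _ h k := .le_inf h k
  left_sup _ := .left_sup _ _
  right_sup _ := .right_sup _ _
  sup_le _ _ _ h k := .sup_le h k
  rel_le _ h := .rel_le h
  rel_ge _ h := .rel_ge h

/-! ### The standard homomorphism of a finitely presented lattice -/

/-- The terms that occur as sides of the relations. -/
def FinPres.sides (Q : FinPres) : Set (Term (Fin Q.n)) := {t | ∃ r ∈ Q.rels, t = r.1 ∨ t = r.2}

theorem FinPres.sides_finite (Q : FinPres) : Q.sides.Finite := by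
  have h : {r | r ∈ Q.rels}.Finite := Q.rels.finite_toSet
  refine ((h.image Prod.fst).union (h.image Prod.snd)).subset ?_
  rintro t ⟨r, hr, rfl | rfl⟩
  · exact .inl ⟨r, hr, rfl⟩
  · exact .inr ⟨r, hr, rfl⟩

theorem FinPres.mem_sides (Q : FinPres) : ∀ r ∈ Q.relSet, r.1 ∈ Q.sides ∧ r.2 ∈ Q.sides :=
  fun r hr => ⟨⟨r, hr, .inl rfl⟩, ⟨r, hr, .inr rfl⟩⟩

theorem FinPres.partialLat_eq (Q : FinPres) :
    Q.partialLat = Presented.mk Q.relSet '' termClosure Q.sides := by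
  rw [FinPres.partialLat, termClosure]
  congr 2
  ext t
  constructor
  · rintro ⟨r, hr, h | h⟩
    · exact ⟨r.1, ⟨r, hr, .inl rfl⟩, h⟩
    · exact ⟨r.2, ⟨r, hr, .inr rfl⟩, h⟩
  · rintro ⟨u, ⟨r, hr, rfl | rfl⟩, h⟩
    · exact ⟨r, hr, .inl h⟩
    · exact ⟨r, hr, .inr h⟩

theorem FinPres.deanCondition (Q : FinPres) : DeanCondition Q.partialLat := by
  refine (deanCondition_presented Q.relSet).mono ?_
  rw [Q.partialLat_eq]
  rintro _ ⟨r, hr, rfl | rfl⟩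
  · exact ⟨_, subset_termClosure _ (Q.mem_sides r hr).1, rfl⟩
  · exact ⟨_, subset_termClosure _ (Q.mem_sides r hr).2, rfl⟩

theorem Presented.eval_mk {α β : Type} {R : Set (Term α × Term α)} {x : β → Presented α R}
    (f : α → β) (hf : ∀ i, x (f i) = mk R (.var i)) (t : Term α) :
    ∃ s : Term β, s.eval x = mk R t := by
  induction t with
  | var i => exact ⟨.var (f i), hf i⟩
  | sup s t hs ht =>
    obtain ⟨p, hp⟩ := hs
    obtain ⟨q, hq⟩ := ht
    exact ⟨.sup p q, by rw [Term.eval, hp, hq, mk_sup]⟩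
  | inf s t hs ht =>
    obtain ⟨p, hp⟩ := hs
    obtain ⟨q, hq⟩ := ht
    exact ⟨.inf p q, by rw [Term.eval, hp, hq, mk_inf]⟩

/-- Finite sets of elements of a presented lattice have least upper bounds, if the lattice has
finitely many generators and is not empty. -/
theorem Presented.exists_isLUB {α : Type} [Finite α] {R : Set (Term α × Term α)}
    [Nonempty (Presented α R)] {U : Set (Presented α R)} (hU : U.Finite) : ∃ x, IsLUB U x := by
  classical
  by_cases hne : U.Nonempty
  · have hne' : hU.toFinset.Nonempty := by simpa using hne
    refine ⟨hU.toFinset.sup' hne' id, ?_⟩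
    simpa using Finset.isLUB_sup' hne'
  · obtain rfl := Set.not_nonempty_iff_eq_empty.1 hne
    have hv : Nonempty α := by
      obtain ⟨x⟩ := ‹Nonempty (Presented α R)›
      obtain ⟨t, -⟩ := mk_surjective x
      induction t with
      | var i => exact ⟨i⟩
      | sup _ _ h _ => exact h
      | inf _ _ h _ => exact h
    have := Fintype.ofFinite α
    -- The meet of the generators is the least element, which is the join of the empty set.
    refine ⟨Finset.univ.inf' Finset.univ_nonempty fun i => mk R (.var i), ?_⟩
    rw [isLUB_empty_iff]
    intro x
    obtain ⟨t, rfl⟩ := mk_surjective x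
    induction t with
    | var i => exact Finset.inf'_le _ (Finset.mem_univ i)
    | sup s t hs _ => exact hs.trans (mk_le_mk_sup_left s t)
    | inf s t hs ht => exact le_inf hs ht

/-- If `a` is least with `s ≤ f a`, then `s ≤ f (g x)` means `a ≤ g x`, and lower boundedness of `g`
at `a` applies. -/
theorem IsLowerBoundedLattice.of_surjective {L S : Type} [Lattice L] [Lattice S]
    (h : IsLowerBoundedLattice L) (f : LatticeHom L S) (hf : Function.Surjective f)
    (hlb : IsLowerBoundedHom f) : IsLowerBoundedLattice S := by
  obtain ⟨n, g, hg, hglb⟩ := h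
  refine ⟨n, f.comp g, hf.comp hg, fun s => ?_⟩
  rcases hlb s with h | ⟨a, ha⟩
  · left
    ext x
    exact ⟨fun hx => h.subset (show g x ∈ {y | s ≤ f y} from hx), fun h => h.elim⟩
  · have : ∀ x, s ≤ f.comp g x ↔ a ≤ g x := fun x =>
      ⟨fun hx => ha.2 hx, fun hx => le_trans ha.1 (OrderHomClass.mono f hx)⟩
    simp only [this]
    exact hglb a

/-- `S` is the image of the lattice among the ideals of `T`. Taking joins gives a map `ι` that is
left adjoint to `f` and satisfies `f (ι I) = I`; this makes `f` lower bounded and identifies the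
range of `ι` with `P^∨`. For the converse of the last claim, all elements of a finite lower bounded
`S` are good, and Dean's condition for `P` lifts this back along `f`. -/
theorem FinPres.standardHom (Q : FinPres) : ∃ (S : Type) (_ : Lattice S) (ι : S ↪o Q.Lat)
        (f : LatticeHom Q.Lat S),
      Finite S ∧ Set.range ι = joins Q.partialLat ∧
      (∀ d : Q.Lat, IsLUB {w | w ∈ joins Q.partialLat ∧ w ≤ d} (ι (f d))) ∧
      Function.Surjective f ∧ IsLowerBoundedHom f ∧
      (IsLowerBoundedLattice Q.Lat ↔ IsLowerBoundedLattice S) := by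
  classical
  set T := termClosure Q.sides with hT
  have hTfin : T.Finite := termClosure_finite Q.sides_finite
  have hsat : Saturated Q.relSet T (TermLE Q.relSet) := saturated_termLE Q.mem_sides
  let φ := TermIdeal.hom hsat
  have hφ : ∀ {p d}, p ∈ (φ d).1 ↔ p ∈ T ∧ Presented.mk Q.relSet p ≤ d :=
    TermIdeal.mem_hom hsat fun _ _ _ _ h => h
  have := TermIdeal.finite (E := TermLE Q.relSet) hTfin
  let S : Sublattice (TermIdeal T (TermLE Q.relSet)) := homRange φ
  let f : LatticeHom Q.Lat S := rangeHom φ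
  have hf : Function.Surjective f := rangeHom_surjective φ
  have hex : ∀ I : S, ∃ x, IsLUB (Presented.mk Q.relSet '' I.1.1) x := fun I => by
    obtain ⟨d, rfl⟩ := hf I
    have : Nonempty Q.Lat := ⟨d⟩
    exact Presented.exists_isLUB ((hTfin.subset (f d).1.2.subset).image _)
  choose ι hι using hex
  have hgc : ∀ I d, ι I ≤ d ↔ I ≤ f d := fun I d => by
    rw [isLUB_le_iff (hι I)]
    refine ⟨fun h p hp => hφ.2 ⟨I.1.2.subset hp, h ⟨p, hp, rfl⟩⟩, ?_⟩
    rintro h _ ⟨p, hp, rfl⟩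
    exact (hφ.1 (h hp)).2
  have hfι : ∀ I, f (ι I) = I := fun I => by
    refine le_antisymm ?_ ((hgc I _).1 le_rfl)
    obtain ⟨d, rfl⟩ := hf I
    exact OrderHomClass.mono f ((hgc _ _).2 le_rfl)
  have hTm : ∀ p ∈ T, ∀ d, Presented.mk Q.relSet p ≤ d ↔
      f (Presented.mk Q.relSet p) ≤ f d := fun p hp d => by
    refine ⟨fun h => OrderHomClass.mono f h, fun h => (hφ.1 (h (hφ.2 ⟨hp, le_rfl⟩))).2⟩
  let ι' : S ↪o Q.Lat := OrderEmbedding.ofMapLEIff ι fun I J => by rw [hgc, hfι]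
  have hιf : ∀ d, ι (f d) ≤ d := fun d => (hgc _ _).2 le_rfl
  have hrange : Set.range ι' = joins Q.partialLat := by
    rw [Q.partialLat_eq]
    ext x
    constructor
    · rintro ⟨I, rfl⟩
      have hfin := (hTfin.subset I.1.2.subset).image (Presented.mk Q.relSet)
      refine ⟨hfin.toFinset, ?_, ?_⟩
      · simpa using Set.image_mono I.1.2.subset
      · rw [Set.Finite.coe_toFinset]; exact hι I
    · rintro ⟨U, hU, hx⟩
      refine ⟨f x, le_antisymm (hιf x) ((isLUB_le_iff hx).2 fun u hu => ?_)⟩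
      obtain ⟨p, hp, rfl⟩ := hU hu
      rw [hTm p hp]
      change f _ ≤ f (ι (f x))
      rw [hfι, ← hTm p hp]
      exact hx.1 hu
  have hlb : IsLowerBoundedHom f := fun I => .inr ⟨ι I, (hfι I).ge, fun d hd => (hgc I d).2 hd⟩
  refine ⟨S, inferInstance, ι', f, inferInstance, hrange, fun d => ?_, hf, hlb,
    fun h => h.of_surjective f hf hlb, fun ⟨m, g, hg, hglb⟩ => ?_⟩
  · refine IsGreatest.isLUB ⟨⟨hrange ▸ ⟨f d, rfl⟩, hιf d⟩, ?_⟩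
    rw [← hrange]
    rintro _ ⟨⟨I, rfl⟩, hId⟩
    exact ι'.monotone ((hgc I d).1 hId)
  -- Surjectivity of `g` excludes the empty alternative.
  · have hgood : ∀ s : S, s ∈ good S := fun s => by
      rcases hglb s with h | ⟨a, ha⟩
      · obtain ⟨y, rfl⟩ := hg s
        exact (h.subset (show y ∈ {z | g y ≤ g z} from le_refl (g y))).elim
      · exact mem_good_of_isLeast g hg ha
    have hP : Q.partialLat.Finite := Q.partialLat_eq ▸ hTfin.image _
    obtain ⟨N, x, hx⟩ := hP.fin_param
    refine (isLowerBoundedLattice_iff x (fun d => ?_) ?_ f hf fun i d => ?_).2 fun i => hgood _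
    · obtain ⟨t, rfl⟩ := mk_surjective d
      have : ∀ i, ∃ j, x j = Presented.mk Q.relSet (.var i) := fun i => by
        have : Presented.mk Q.relSet (.var i) ∈ Set.range x := by
          rw [hx.2, Q.partialLat_eq]; exact ⟨_, hsat.var_mem i, rfl⟩
        exact this
      choose j hj using this
      exact Presented.eval_mk j hj t
    · rw [hx.2]; exact Q.deanCondition
    · have : x i ∈ Q.partialLat := hx.2 ▸ ⟨i, rfl⟩
      rw [Q.partialLat_eq] at this
      obtain ⟨p, hp, h⟩ := this
      rw [← h]
      exact (hTm p hp d).2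

/-! ### Programs and their running times -/

namespace Val

theorem size_pos (v : Val) : 0 < v.size := by cases v <;> simp [Val.size]

theorem size_left_le (v : Val) : v.left.size ≤ v.size := by
  cases v with
  | nil => exact le_rfl
  | node a b => simp only [Val.left, Val.size]; omega

theorem size_right_le (v : Val) : v.right.size ≤ v.size := by
  cases v with
  | nil => exact le_rfl
  | node a b => simp only [Val.right, Val.size]; omega

/-- A tree read as the list of the left subtrees along its right spine. -/
def toList : Val → List Val
  | .nil => []
  | .node a l => a :: l.toList

/-- A case distinction on whether a tree is `nil`. -/
def cond : Val → Val → Val → Val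
  | .nil, _, b => b
  | .node _ _, a, _ => a

/-- A truth value as a tree. -/
noncomputable def ofProp (p : Prop) : Val := open Classical in if p then .node .nil .nil else .nil

theorem ofProp_ne_nil {p : Prop} : ofProp p ≠ .nil ↔ p := by
  by_cases h : p <;> simp [ofProp, h]

theorem ofProp_true {p : Prop} (h : p) : ofProp p = .node .nil .nil := by simp [ofProp, h]

theorem ofProp_false {p : Prop} (h : ¬ p) : ofProp p = .nil := by simp [ofProp, h]

/-- Primitive recursion along the right spine. -/
def listRec (b s : Val → Val) (e : Val) : Val → Val
  | .nil => b e
  | .node a l => s (.node e (.node a (.node l (listRec b s e l))))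

/-- Primitive recursion on trees. -/
def treeRec (b s : Val → Val) : Val → Val
  | .nil => b .nil
  | .node a l => s (.node (.node a l) (.node (treeRec b s a) (treeRec b s l)))

end Val

open Val

/-- `f` is computed within `T` steps by an expression that calls functions of a block of
code; the block can be placed at any position in a program. -/
def Runs (f : Val → Val) (T : Val → ℕ) : Prop :=
  ∀ k : ℕ, ∃ (B : List Exp) (e : Exp), ∀ A C : List Exp, A.length = k → ∀ (v : Val) (ρ : List Val),
    ∃ t ≤ T v, Evals (A ++ (B ++ C)) (v :: ρ) e (f v) t

namespace Runs

variable {f g c : Val → Val} {S T U : Val → ℕ}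

theorem id : Runs (fun v => v) (fun _ => 1) := fun _ =>
  ⟨[], .var 0, fun _ _ _ v ρ => ⟨1, le_rfl, .var (v :: ρ) 0⟩⟩

theorem nil : Runs (fun _ => .nil) (fun _ => 1) := fun _ =>
  ⟨[], .nil, fun _ _ _ v ρ => ⟨1, le_rfl, .nil (v :: ρ)⟩⟩

theorem left (h : Runs f T) : Runs (fun v => (f v).left) (fun v => T v + 1) := fun k => by
  obtain ⟨B, e, h⟩ := h k
  refine ⟨B, .hd e, fun A C hA v ρ => ?_⟩
  obtain ⟨t, ht, h⟩ := h A C hA v ρ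
  exact ⟨t + 1, by dsimp only; omega, .hd h⟩

theorem right (h : Runs f T) : Runs (fun v => (f v).right) (fun v => T v + 1) := fun k => by
  obtain ⟨B, e, h⟩ := h k
  refine ⟨B, .tl e, fun A C hA v ρ => ?_⟩
  obtain ⟨t, ht, h⟩ := h A C hA v ρ
  exact ⟨t + 1, by dsimp only; omega, .tl h⟩

/-- Two computations placed next to each other in one program. -/
theorem both (hf : Runs f T) (hg : Runs g U) (k : ℕ) : ∃ (B : List Exp) (e e' : Exp),
    ∀ A C : List Exp, A.length = k →
      (∀ (v : Val) (ρ : List Val), ∃ t ≤ T v, Evals (A ++ (B ++ C)) (v :: ρ) e (f v) t) ∧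
      ∀ (v : Val) (ρ : List Val), ∃ t ≤ U v, Evals (A ++ (B ++ C)) (v :: ρ) e' (g v) t := by
  obtain ⟨B, e, h⟩ := hf k
  obtain ⟨B', e', h'⟩ := hg (k + B.length)
  refine ⟨B ++ B', e, e', fun A C hA => ⟨fun v ρ => ?_, fun v ρ => ?_⟩⟩
  · rw [List.append_assoc]
    exact h A (B' ++ C) hA v ρ
  · have := h' (A ++ B) C (by simp [hA]) v ρ
    simpa [List.append_assoc] using this

theorem node (hf : Runs f T) (hg : Runs g U) :
    Runs (fun v => .node (f v) (g v)) (fun v => T v + U v + 1) := fun k => by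
  obtain ⟨B, e, e', h⟩ := both hf hg k
  refine ⟨B, .cons e e', fun A C hA v ρ => ?_⟩
  obtain ⟨h1, h2⟩ := h A C hA
  obtain ⟨t, ht, h1⟩ := h1 v ρ
  obtain ⟨u, hu, h2⟩ := h2 v ρ
  exact ⟨t + u + 1, by dsimp only; omega, .cons h1 h2⟩

theorem comp (hg : Runs g U) (hf : Runs f T) :
    Runs (fun v => g (f v)) (fun v => T v + U (f v) + 1) := fun k => by
  obtain ⟨B, e, e', h⟩ := both hf hg k
  refine ⟨B, .letE e e', fun A C hA v ρ => ?_⟩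
  obtain ⟨h1, h2⟩ := h A C hA
  obtain ⟨t, ht, h1⟩ := h1 v ρ
  obtain ⟨u, hu, h2⟩ := h2 (f v) (v :: ρ)
  exact ⟨t + u + 1, by dsimp only; omega, .letE h1 h2⟩

theorem cond (hc : Runs c S) (hf : Runs f T) (hg : Runs g U) :
    Runs (fun v => Val.cond (c v) (f v) (g v)) (fun v => S v + (T v + U v) + 1) := fun k => by
  obtain ⟨B, e, h⟩ := hc k
  obtain ⟨B', e₁, e₂, h'⟩ := both hf hg (k + B.length)
  refine ⟨B ++ B', .ite e e₁ e₂, fun A C hA v ρ => ?_⟩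
  obtain ⟨s, hs, h⟩ := h A (B' ++ C) hA v ρ
  obtain ⟨h1, h2⟩ := h' (A ++ B) C (by simp [hA])
  obtain ⟨t, ht, h1⟩ := h1 v ρ
  obtain ⟨u, hu, h2⟩ := h2 v ρ
  simp only [List.append_assoc] at h h1 h2 ⊢
  cases hcv : c v with
  | nil =>
    rw [hcv] at h
    exact ⟨s + u + 1, by omega, .ite_false h h2⟩
  | node x y =>
    rw [hcv] at h
    exact ⟨s + t + 1, by omega, .ite_true h h1⟩

theorem getD_block (A B C : List Exp) (e : Exp) :
    (A ++ ((e :: B) ++ C)).getD A.length .nil = e := by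
  simp [List.getD]

/-- The recursion is the function at position `k`; its argument pairs the parameter with the
remaining list. The bound `n` on the results controls the argument of each step, so all steps obey
one cost bound and their number is at most the size of the list. -/
theorem listRec {b s : Val → Val} {m n : ℕ → ℕ} (hm : Monotone m) (hn : Monotone n)
    (hb : Runs b T) (hs : Runs s U) (hU : ∀ v, U v ≤ m v.size)
    (hsize : ∀ v : Val, (Val.listRec b s v.left v.right).size ≤ n v.size) :
    Runs (fun v => Val.listRec b s v.left v.right)
      (fun v => T v.left + v.size * (m (2 * (v.size + 2) + n (v.size + 2) + 4) + 25) + 30) := fun k => by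
  obtain ⟨B, eb, es, h⟩ := both hb hs (k + 1)
  -- Inside the first `letE`, variable `0` is the recursive value and variable `1` the argument of
  -- the function.
  let body : Exp := .ite (.tl (.var 0))
    (.letE (.call k (.cons (.hd (.var 0)) (.tl (.tl (.var 0)))))
      (.letE (.cons (.hd (.var 1)) (.cons (.hd (.tl (.var 1))) (.cons (.tl (.tl (.var 1))) (.var 0))))
        es))
    (.letE (.hd (.var 0)) eb)
  refine ⟨body :: B, .letE (.cons (.hd (.var 0)) (.tl (.var 0))) (.call k (.var 0)),
    fun A C hA v ρ => ?_⟩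
  have hAB : A ++ ((body :: B) ++ C) = (A ++ [body]) ++ (B ++ C) := by simp
  obtain ⟨h1, h2⟩ := h (A ++ [body]) C (by simp [hA])
  rw [← hAB] at h1 h2
  set P : Program := A ++ ((body :: B) ++ C) with hP
  have hbody : P.getD k .nil = body := hA ▸ getD_block A B C body
  -- `N` stays fixed along the recursion, so that the cost of a step is uniform.
  have main : ∀ (e l : Val) (N : ℕ), e.size + l.size + 1 ≤ N →
      ∃ t ≤ T e + l.size * (m (2 * N + n N + 4) + 25) + 10,
        Evals P [.node e l] body (Val.listRec b s e l) t := by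
    intro e l N
    induction l with
    | nil =>
      intro hN
      obtain ⟨t, ht, h1⟩ := h1 e [.node e .nil]
      refine ⟨2 + (2 + t + 1) + 1, by omega, .ite_false ?_ ?_⟩
      · exact .tl (.var [.node e .nil] 0)
      · exact .letE (.hd (.var [.node e .nil] 0)) h1
    | node a l _ ih =>
      intro hN
      have hN' : e.size + (a.size + l.size + 1) + 1 ≤ N := hN
      obtain ⟨t, ht, hl⟩ := ih (by omega)
      obtain ⟨u, hu, hs'⟩ := h2 (.node e (.node a (.node l (Val.listRec b s e l))))
        [Val.listRec b s e l, .node e (.node a l)]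
      have hsz : (Val.listRec b s e l).size ≤ n N := by
        refine (hsize (.node e l)).trans (hn ?_)
        simp only [Val.size]; omega
      have hu' : u ≤ m (2 * N + n N + 4) := by
        refine hu.trans ((hU _).trans (hm ?_))
        simp only [Val.size]
        omega
      let ρ₀ : List Val := [.node e (.node a l)]
      let ρ₁ : List Val := [Val.listRec b s e l, .node e (.node a l)]
      refine ⟨2 + ((2 + 3 + 1 + t + 1) + ((2 + (3 + (3 + 1 + 1) + 1) + 1) + u + 1) + 1) + 1, ?_, ?_⟩
      · simp only [Val.size, Nat.add_mul, one_mul]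
        omega
      · refine .ite_true (.tl (.var ρ₀ 0)) (.letE (.call (u := .node e l) ?_ (hbody.symm ▸ hl))
          (.letE ?_ hs'))
        · exact .cons (.hd (.var ρ₀ 0)) (.tl (.tl (.var ρ₀ 0)))
        · exact .cons (.hd (.var ρ₁ 1)) (.cons (.hd (.tl (.var ρ₁ 1)))
            (.cons (.tl (.tl (.var ρ₁ 1))) (.var ρ₁ 0)))
  have hl := v.size_left_le
  have hr := v.size_right_le
  -- For `v = nil` the two parts are again `nil` and the sum is `3`, whence the summand `2`.
  have hsum : v.left.size + v.right.size + 1 ≤ v.size + 2 := by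
    cases v <;> simp only [Val.left, Val.right, Val.size] <;> omega
  obtain ⟨t, ht, h⟩ := main v.left v.right (v.size + 2) hsum
  refine ⟨(2 + 2 + 1) + (1 + t + 1) + 1, ?_, ?_⟩
  · have := Nat.mul_le_mul_right (m (2 * (v.size + 2) + n (v.size + 2) + 4) + 25) hr
    dsimp only
    omega
  · refine .letE (.cons (.hd (.var (v :: ρ) 0)) (.tl (.var (v :: ρ) 0)))
      (.call (.var (Val.node v.left v.right :: v :: ρ) 0) (hbody.symm ▸ h))

theorem treeRec {b s : Val → Val} {m n : ℕ → ℕ} (hm : Monotone m) (hn : Monotone n)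
    (hb : Runs b T) (hs : Runs s U) (hU : ∀ v, U v ≤ m v.size)
    (hsize : ∀ v : Val, (Val.treeRec b s v).size ≤ n v.size) :
    Runs (Val.treeRec b s)
      (fun v => v.size * (T .nil + m (v.size + 2 * n v.size + 4) + 25) + 2) := fun k => by
  obtain ⟨B, eb, es, h⟩ := both hb hs (k + 1)
  let body : Exp := .ite (.var 0)
    (.letE (.cons (.var 0) (.cons (.call k (.hd (.var 0))) (.call k (.tl (.var 0))))) es)
    (.letE .nil eb)
  refine ⟨body :: B, .call k (.var 0), fun A C hA v ρ => ?_⟩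
  have hAB : A ++ ((body :: B) ++ C) = (A ++ [body]) ++ (B ++ C) := by simp
  obtain ⟨h1, h2⟩ := h (A ++ [body]) C (by simp [hA])
  rw [← hAB] at h1 h2
  set P : Program := A ++ ((body :: B) ++ C) with hP
  have hbody : P.getD k .nil = body := hA ▸ getD_block A B C body
  have main : ∀ (v : Val) (N : ℕ), v.size ≤ N →
      ∃ t ≤ v.size * (T .nil + m (N + 2 * n N + 4) + 25),
        Evals P [v] body (Val.treeRec b s v) t := by
    intro v N
    induction v with
    | nil =>
      intro hN
      obtain ⟨t, ht, h1⟩ := h1 .nil [.nil]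
      refine ⟨1 + (1 + t + 1) + 1, ?_, .ite_false (.var [.nil] 0) (.letE (.nil _) h1)⟩
      simp only [Val.size]
      omega
    | node a l iha ihl =>
      intro hN
      have hN' : a.size + l.size + 1 ≤ N := hN
      obtain ⟨t, ht, ha⟩ := iha (by omega)
      obtain ⟨t', ht', hl⟩ := ihl (by omega)
      obtain ⟨u, hu, hs'⟩ := h2 (.node (.node a l) (.node (Val.treeRec b s a) (Val.treeRec b s l)))
        [.node a l]
      have hsa : (Val.treeRec b s a).size ≤ n N := (hsize a).trans (hn (by omega))
      have hsl : (Val.treeRec b s l).size ≤ n N := (hsize l).trans (hn (by omega))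
      have hu' : u ≤ m (N + 2 * n N + 4) := by
        refine hu.trans ((hU _).trans (hm ?_))
        simp only [Val.size]
        omega
      let ρ₀ : List Val := [.node a l]
      refine ⟨1 + ((1 + ((2 + t + 1) + (2 + t' + 1) + 1) + 1) + u + 1) + 1, ?_, ?_⟩
      · simp only [Val.size, Nat.add_mul, one_mul]
        omega
      · exact .ite_true (.var ρ₀ 0) (.letE (.cons (.var ρ₀ 0)
          (.cons (.call (.hd (.var ρ₀ 0)) (hbody.symm ▸ ha))
            (.call (.tl (.var ρ₀ 0)) (hbody.symm ▸ hl)))) hs')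
  obtain ⟨t, ht, h⟩ := main v v.size le_rfl
  exact ⟨1 + t + 1, by dsimp only; omega, .call (.var (v :: ρ) 0) (hbody.symm ▸ h)⟩

/-- The comparison of two trees. -/
theorem eq : Runs (fun v => ofProp (v.left = v.right)) (fun v => 50 * v.size + 2) := fun k => by
  let x : Exp := .hd (.var 0)
  let y : Exp := .tl (.var 0)
  let body : Exp := .ite x
    (.ite y (.ite (.call k (.cons (.hd x) (.hd y))) (.call k (.cons (.tl x) (.tl y))) .nil) .nil)
    (.ite y .nil (.cons .nil .nil))
  refine ⟨[body], .letE (.cons x y) (.call k (.var 0)), fun A C hA v ρ => ?_⟩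
  set P : Program := A ++ ([body] ++ C) with hP
  have hbody : P.getD k .nil = body := hA ▸ getD_block A [] C body
  have hx : ∀ a b, Evals P [.node a b] x a 2 := fun a b => .hd (.var [.node a b] 0)
  have hy : ∀ a b, Evals P [.node a b] y b 2 := fun a b => .tl (.var [.node a b] 0)
  -- Both trees are descended in parallel, so the size of the first one alone bounds the time.
  have main : ∀ a b : Val, ∃ t ≤ 35 * a.size, Evals P [.node a b] body (ofProp (a = b)) t := by
    intro a
    induction a with
    | nil =>
      intro b
      cases b with
      | nil =>
        rw [ofProp_true rfl]
        exact ⟨2 + (2 + (1 + 1 + 1) + 1) + 1, by simp [Val.size],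
          .ite_false (hx _ _) (.ite_false (hy _ _) (.cons (.nil _) (.nil _)))⟩
      | node c d =>
        rw [ofProp_false (by simp)]
        exact ⟨2 + (2 + 1 + 1) + 1, by simp [Val.size],
          .ite_false (hx _ _) (.ite_true (hy _ _) (.nil _))⟩
    | node a₁ a₂ h₁ h₂ =>
      intro b
      cases b with
      | nil =>
        rw [ofProp_false (by simp)]
        exact ⟨2 + (2 + 1 + 1) + 1, by simp only [Val.size]; omega,
          .ite_true (hx _ _) (.ite_false (hy _ _) (.nil _))⟩
      | node b₁ b₂ =>
        obtain ⟨t₁, ht₁, h₁⟩ := h₁ b₁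
        obtain ⟨t₂, ht₂, h₂⟩ := h₂ b₂
        have e₁ : Evals P [.node (.node a₁ a₂) (.node b₁ b₂)]
            (.call k (.cons (.hd x) (.hd y))) (ofProp (a₁ = b₁)) ((3 + 3 + 1) + t₁ + 1) :=
          .call (.cons (.hd (hx _ _)) (.hd (hy _ _))) (hbody.symm ▸ h₁)
        have e₂ : Evals P [.node (.node a₁ a₂) (.node b₁ b₂)]
            (.call k (.cons (.tl x) (.tl y))) (ofProp (a₂ = b₂)) ((3 + 3 + 1) + t₂ + 1) :=
          .call (.cons (.tl (hx _ _)) (.tl (hy _ _))) (hbody.symm ▸ h₂)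
        by_cases h : a₁ = b₁
        · rw [ofProp_true h] at e₁
          have : ofProp (Val.node a₁ a₂ = .node b₁ b₂) = ofProp (a₂ = b₂) := by
            simp [h]
          rw [this]
          refine ⟨_, ?_, .ite_true (hx _ _) (.ite_true (hy _ _) (.ite_true e₁ e₂))⟩
          simp only [Val.size]
          omega
        · rw [ofProp_false h] at e₁
          rw [ofProp_false (by simp [h])]
          refine ⟨_, ?_, .ite_true (hx _ _) (.ite_true (hy _ _) (.ite_false e₁ (.nil _)))⟩
          simp only [Val.size]
          omega
  obtain ⟨t, ht, h⟩ := main v.left v.right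
  have := v.size_left_le
  have := v.size_pos
  exact ⟨(2 + 2 + 1) + (1 + t + 1) + 1, by dsimp only; omega,
    .letE (.cons (.hd (.var (v :: ρ) 0)) (.tl (.var (v :: ρ) 0)))
      (.call (.var (Val.node v.left v.right :: v :: ρ) 0) (hbody.symm ▸ h))⟩

end Runs

/-! ### Polynomial bounds -/

/-- `T` is bounded by a polynomial in the size of its argument. -/
def PolyBd (T : Val → ℕ) : Prop := ∃ c, ∀ v, T v ≤ (v.size + 1) ^ c

namespace PolyBd

variable {S T : Val → ℕ}

theorem mono (h : PolyBd T) (hST : ∀ v, S v ≤ T v) : PolyBd S :=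
  h.imp fun _ hc v => (hST v).trans (hc v)

/-- A base of at least `2` lets sums and constants be absorbed into the exponent. -/
theorem two_le (v : Val) : 2 ≤ v.size + 1 := by have := v.size_pos; omega

theorem const (k : ℕ) : PolyBd fun _ => k :=
  ⟨k, fun v => (Nat.lt_two_pow_self.le).trans (Nat.pow_le_pow_left (two_le v) k)⟩

theorem size : PolyBd Val.size := ⟨1, fun v => by simp⟩

theorem mul (hS : PolyBd S) (hT : PolyBd T) : PolyBd fun v => S v * T v := by
  obtain ⟨c, hc⟩ := hS
  obtain ⟨d, hd⟩ := hT
  exact ⟨c + d, fun v => by rw [pow_add]; exact Nat.mul_le_mul (hc v) (hd v)⟩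

theorem add (hS : PolyBd S) (hT : PolyBd T) : PolyBd fun v => S v + T v := by
  obtain ⟨c, hc⟩ := hS
  obtain ⟨d, hd⟩ := hT
  refine ⟨c + d + 1, fun v => ?_⟩
  have h1 : (v.size + 1) ^ c ≤ (v.size + 1) ^ (c + d) :=
    Nat.pow_le_pow_right (by omega) (by omega)
  have h2 : (v.size + 1) ^ d ≤ (v.size + 1) ^ (c + d) :=
    Nat.pow_le_pow_right (by omega) (by omega)
  calc S v + T v ≤ (v.size + 1) ^ (c + d) * 2 := by
        have := hc v
        have := hd v
        omega
    _ ≤ (v.size + 1) ^ (c + d) * (v.size + 1) := Nat.mul_le_mul_left _ (two_le v)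
    _ = _ := (pow_succ _ _).symm

theorem pow (hT : PolyBd T) (k : ℕ) : PolyBd fun v => T v ^ k := by
  obtain ⟨c, hc⟩ := hT
  exact ⟨c * k, fun v => by rw [pow_mul]; exact Nat.pow_le_pow_left (hc v) k⟩

theorem comp (hT : PolyBd T) {f : Val → Val} (hf : PolyBd fun v => (f v).size) :
    PolyBd fun v => T (f v) := by
  obtain ⟨c, hc⟩ := hT
  exact ((hf.add (const 1)).pow c).mono fun v => hc (f v)

end PolyBd

/-- `f` is computable in polynomial time, with values of polynomial size. -/
def FP (f : Val → Val) : Prop :=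
  (PolyBd fun v => (f v).size) ∧ ∃ T, PolyBd T ∧ Runs f T

/-- The property `φ` of trees is decidable in polynomial time. -/
def DP (φ : Val → Prop) : Prop := FP fun v => ofProp (φ v)

namespace FP

variable {f g c : Val → Val}

theorem id : FP fun v => v := ⟨.size, _, .const 1, .id⟩

theorem nil : FP fun _ => .nil := ⟨.const 1, _, .const 1, .nil⟩

theorem left (hf : FP f) : FP fun v => (f v).left := by
  obtain ⟨h1, T, h2, h3⟩ := hf
  exact ⟨h1.mono fun v => (f v).size_left_le, _, h2.add (.const 1), h3.left⟩

theorem right (hf : FP f) : FP fun v => (f v).right := by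
  obtain ⟨h1, T, h2, h3⟩ := hf
  exact ⟨h1.mono fun v => (f v).size_right_le, _, h2.add (.const 1), h3.right⟩

theorem node (hf : FP f) (hg : FP g) : FP fun v => .node (f v) (g v) := by
  obtain ⟨h1, T, h2, h3⟩ := hf
  obtain ⟨k1, U, k2, k3⟩ := hg
  exact ⟨(h1.add k1).add (.const 1), _, (h2.add k2).add (.const 1), h3.node k3⟩

theorem comp (hg : FP g) (hf : FP f) : FP fun v => g (f v) := by
  obtain ⟨h1, T, h2, h3⟩ := hf
  obtain ⟨k1, U, k2, k3⟩ := hg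
  exact ⟨k1.comp h1, _, (h2.add (k2.comp h1)).add (.const 1), k3.comp h3⟩

theorem cond (hc : FP c) (hf : FP f) (hg : FP g) : FP fun v => Val.cond (c v) (f v) (g v) := by
  obtain ⟨l1, S, l2, l3⟩ := hc
  obtain ⟨h1, T, h2, h3⟩ := hf
  obtain ⟨k1, U, k2, k3⟩ := hg
  refine ⟨(h1.add k1).mono fun v => ?_, _, (l2.add (h2.add k2)).add (.const 1), l3.cond h3 k3⟩
  dsimp only
  generalize c v = x
  cases x <;> simp [Val.cond]

theorem const (u : Val) : FP fun _ => u := by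
  induction u with
  | nil => exact nil
  | node a b ha hb => exact ha.node hb

/-- Polynomial steps may still build exponentially large values, as `sublists` does; the a priori
size bound `h` rules this out. -/
theorem listRec {b s : Val → Val} (hb : FP b) (hs : FP s)
    (h : PolyBd fun v => (Val.listRec b s v.left v.right).size) {l : Val → Val}
    (hf : FP f) (hl : FP l) : FP fun v => Val.listRec b s (f v) (l v) := by
  suffices FP fun v => Val.listRec b s v.left v.right from this.comp (hf.node hl)
  refine ⟨h, ?_⟩
  obtain ⟨-, T, h2, h3⟩ := hb
  obtain ⟨-, U, ⟨c, k2⟩, k3⟩ := hs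
  obtain ⟨d, h⟩ := h
  refine ⟨_, ?_, Runs.listRec (m := fun x => (x + 1) ^ c) (n := fun x => (x + 1) ^ d)
    (fun _ _ h => Nat.pow_le_pow_left (by omega) _) (fun _ _ h => Nat.pow_le_pow_left (by omega) _)
    h3 k3 k2 h⟩
  have hv : PolyBd fun v => v.size + 2 := PolyBd.size.add (.const 2)
  refine ((h2.comp (id.left).1).add (PolyBd.size.mul (PolyBd.add ?_ (.const _)))).add (.const _)
  exact (((((PolyBd.const 2).mul hv).add ((hv.add (.const 1)).pow d)).add (.const 4)).add
    (.const 1)).pow c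

theorem treeRec {b s : Val → Val} (hb : FP b) (hs : FP s)
    (h : PolyBd fun v => (Val.treeRec b s v).size) (hf : FP f) :
    FP fun v => Val.treeRec b s (f v) := by
  suffices FP fun v => Val.treeRec b s v from this.comp hf
  refine ⟨h, ?_⟩
  obtain ⟨-, T, h2, h3⟩ := hb
  obtain ⟨-, U, ⟨c, k2⟩, k3⟩ := hs
  obtain ⟨d, h⟩ := h
  refine ⟨_, ?_, Runs.treeRec (m := fun x => (x + 1) ^ c) (n := fun x => (x + 1) ^ d)
    (fun _ _ h => Nat.pow_le_pow_left (by omega) _) (fun _ _ h => Nat.pow_le_pow_left (by omega) _)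
    h3 k3 k2 h⟩
  refine (PolyBd.size.mul (((PolyBd.const _).add ?_).add (.const _))).add (.const _)
  exact (((PolyBd.size.add ((PolyBd.const 2).mul ((PolyBd.size.add (.const 1)).pow d))).add
    (.const 4)).add (.const 1)).pow c

end FP

/-! ### List operations in polynomial time -/

namespace Val

/-- Concatenation of lists. -/
def append (x y : Val) : Val :=
  listRec (fun e => e) (fun w => .node w.right.left w.right.right.right) y x

theorem append_nil (y : Val) : append .nil y = y := rfl

theorem append_node (a x y : Val) : append (.node a x) y = .node a (append x y) := rfl

theorem toList_append (x y : Val) : (append x y).toList = x.toList ++ y.toList := by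
  induction x with
  | nil => rfl
  | node a x _ ih => rw [append_node, toList, toList, ih, List.cons_append]

theorem size_append_le (x y : Val) : (append x y).size ≤ x.size + y.size := by
  induction x with
  | nil => rw [append_nil]; omega
  | node a x _ ih => rw [append_node]; simp only [Val.size]; omega

/-- The concatenation of the lists `f (node e a)`, for the members `a` of a list. -/
def bind (f : Val → Val) (e : Val) (l : Val) : Val :=
  listRec (fun _ => .nil) (fun w => append (f (.node w.left w.right.left)) w.right.right.right) e l

theorem bind_nil (f : Val → Val) (e : Val) : bind f e .nil = .nil := rfl

theorem bind_node (f : Val → Val) (e a l : Val) :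
    bind f e (.node a l) = append (f (.node e a)) (bind f e l) := rfl

theorem mem_bind {f : Val → Val} {e l x : Val} :
    x ∈ (bind f e l).toList ↔ ∃ a ∈ l.toList, x ∈ (f (.node e a)).toList := by
  induction l with
  | nil => simp [bind_nil, toList]
  | node a l _ ih => simp [bind_node, toList_append, toList, ih]

theorem size_bind_le {f : Val → Val} {m : ℕ → ℕ} (hm : Monotone m) (hf : ∀ v, (f v).size ≤ m v.size)
    (e l : Val) : (bind f e l).size ≤ 1 + l.size * m (e.size + l.size + 1) := by
  suffices ∀ N, e.size + l.size + 1 ≤ N → (bind f e l).size ≤ 1 + l.size * m N from this _ le_rfl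
  intro N
  induction l with
  | nil => intro _; rw [bind_nil]; simp [Val.size]
  | node a l _ ih =>
    intro hN
    have hN' : e.size + (a.size + l.size + 1) + 1 ≤ N := hN
    have h1 := ih (by omega)
    have h2 : (f (.node e a)).size ≤ m N :=
      (hf _).trans (hm (by simp only [Val.size]; omega))
    have h3 := size_append_le (f (.node e a)) (bind f e l)
    rw [bind_node]
    simp only [Val.size, Nat.add_mul, one_mul]
    omega

/-- The members of a list that satisfy `φ`. -/
noncomputable def filter (φ : Val → Prop) : Val → Val
  | .nil => .nil
  | .node a l => append (cond (ofProp (φ a)) (.node a .nil) .nil) (filter φ l)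

theorem filter_node_of_pos {φ : Val → Prop} {a : Val} (l : Val) (h : φ a) :
    filter φ (.node a l) = .node a (filter φ l) := by
  rw [filter, ofProp_true h]; rfl

theorem filter_node_of_neg {φ : Val → Prop} {a : Val} (l : Val) (h : ¬ φ a) :
    filter φ (.node a l) = filter φ l := by
  rw [filter, ofProp_false h]; rfl

theorem mem_filter {φ : Val → Prop} {l x : Val} :
    x ∈ (filter φ l).toList ↔ x ∈ l.toList ∧ φ x := by
  induction l with
  | nil => simp [filter, toList]
  | node a l _ ih =>
    by_cases h : φ a
    · rw [filter_node_of_pos l h]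
      simp only [toList, List.mem_cons, ih]
      constructor
      · rintro (rfl | ⟨h1, h2⟩)
        · exact ⟨.inl rfl, h⟩
        · exact ⟨.inr h1, h2⟩
      · rintro ⟨rfl | h1, h2⟩
        · exact .inl rfl
        · exact .inr ⟨h1, h2⟩
    · rw [filter_node_of_neg l h]
      simp only [toList, List.mem_cons, ih]
      constructor
      · rintro ⟨h1, h2⟩
        exact ⟨.inr h1, h2⟩
      · rintro ⟨rfl | h1, h2⟩
        · exact (h h2).elim
        · exact ⟨h1, h2⟩

theorem size_filter_le (φ : Val → Prop) (l : Val) : (filter φ l).size ≤ l.size := by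
  induction l with
  | nil => exact le_rfl
  | node a l _ ih =>
    by_cases h : φ a
    · rw [filter_node_of_pos l h]; simp only [Val.size]; omega
    · rw [filter_node_of_neg l h]; simp only [Val.size]; omega

/-- This form hands the parameter of the predicate to each test, so `filter` inherits its polynomial
bounds from `bind`. -/
theorem filter_eq_bind (φ : Val → Val → Prop) (e l : Val) : filter (φ e) l =
    bind (fun w => cond (ofProp (φ w.left w.right)) (.node w.right .nil) .nil) e l := by
  induction l with
  | nil => rfl
  | node a l _ ih => rw [bind_node, ← ih]; rfl

theorem cond_ofProp_ne_nil (c : Val) : ofProp (c ≠ .nil) = cond c (.node .nil .nil) .nil := by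
  cases c with
  | nil => exact ofProp_false (by simp)
  | node a b => exact ofProp_true (by simp)

theorem exists_mem_iff_filter_ne_nil {φ : Val → Prop} {l : Val} :
    (∃ x ∈ l.toList, φ x) ↔ filter φ l ≠ .nil := by
  have h : filter φ l ≠ .nil ↔ ∃ x, x ∈ (filter φ l).toList := by
    cases filter φ l with
    | nil => simp [toList]
    | node a l => simp [toList]
  simp only [h, mem_filter]

/-- The iterates of the operator `st ↦ {x ∈ U | φ st x}` along the list `c`. -/
noncomputable def iter (φ : Val → Val → Prop) (U : Val) : Val → Val
  | .nil => .nil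
  | .node _ c => filter (φ (iter φ U c)) U

/-- The least fixed point of the operator `st ↦ {x ∈ U | φ st x}`. -/
noncomputable def lfp (φ : Val → Val → Prop) (U : Val) : Val := iter φ U U

/-- Monotonicity of an operator on lists, as an operator on sets. -/
def MonoOp (φ : Val → Val → Prop) : Prop :=
  ∀ s t x : Val, (∀ y ∈ s.toList, y ∈ t.toList) → φ s x → φ t x

theorem mem_of_mem_lfp {φ : Val → Val → Prop} {U x : Val} (h : x ∈ (lfp φ U).toList) :
    x ∈ U.toList := by
  rw [lfp] at h
  cases U with
  | nil => exact h
  | node a c => exact (mem_filter.1 h).1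

/-- No monotonicity is needed: each iterate is produced by the operator from the previous one. -/
theorem lfp_induction {φ : Val → Val → Prop} {U : Val} {Q : Val → Prop} {x : Val}
    (hx : x ∈ (lfp φ U).toList)
    (hQ : ∀ s x, (∀ y ∈ s.toList, Q y ∧ y ∈ U.toList) → x ∈ U.toList → φ s x → Q x) : Q x := by
  have : ∀ c, ∀ x ∈ (iter φ U c).toList, Q x ∧ x ∈ U.toList := by
    intro c
    induction c with
    | nil => intro x hx; simp [iter, toList] at hx
    | node a c _ ih =>
      intro x hx
      rw [iter, mem_filter] at hx
      exact ⟨hQ _ x ih hx.1 hx.2, hx.1⟩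
  exact (this U x hx).1

/-- The iterates of a monotone operator increase. Until they become stationary each one gains a
member of `U`, so the length of `U` suffices as the number of iterations. -/
theorem mem_lfp {φ : Val → Val → Prop} (hφ : MonoOp φ) {U x : Val} (hx : x ∈ U.toList)
    (h : φ (lfp φ U) x) : x ∈ (lfp φ U).toList := by
  classical
  let st : Val → Finset Val := fun c => (iter φ U c).toList.toFinset
  have hmono : ∀ a c, st c ⊆ st (.node a c) := by
    intro a c
    induction c generalizing a with
    | nil => intro x hx; simp [st, iter, toList] at hx
    | node b c _ ih =>
      intro x hx
      simp only [st, List.mem_toFinset] at hx ih ⊢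
      rw [iter, mem_filter] at hx ⊢
      refine ⟨hx.1, hφ _ _ x (fun y hy => ?_) hx.2⟩
      have := ih b
      simpa using this (by simpa using hy)
  -- The list `c` serves as a step counter: either the chain has stopped, or it has at least as many
  -- members as there were steps.
  have hstab : ∀ a c, (st (.node a c) = st c ∨ c.toList.length ≤ (st c).card) := by
    intro a c
    induction c generalizing a with
    | nil => right; simp [toList]
    | node b c _ ih =>
      rcases ih b with h | h
      · left
        ext x
        simp only [st, List.mem_toFinset] at h ⊢
        rw [iter, iter, mem_filter, mem_filter]
        have h' : ∀ y, y ∈ (iter φ U (.node b c)).toList ↔ y ∈ (iter φ U c).toList := fun y => by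
          simpa using Finset.ext_iff.1 h y
        exact and_congr_right fun _ => ⟨fun k => hφ _ _ x (fun y hy => (h' y).1 hy) k,
          fun k => hφ _ _ x (fun y hy => (h' y).2 hy) k⟩
      · by_cases heq : st (.node b c) = st c
        · left
          ext x
          simp only [st, List.mem_toFinset] at heq ⊢
          rw [iter, iter, mem_filter, mem_filter]
          have h' : ∀ y, y ∈ (iter φ U (.node b c)).toList ↔ y ∈ (iter φ U c).toList := fun y => by
            simpa using Finset.ext_iff.1 heq y
          exact and_congr_right fun _ => ⟨fun k => hφ _ _ x (fun y hy => (h' y).1 hy) k,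
            fun k => hφ _ _ x (fun y hy => (h' y).2 hy) k⟩
        · right
          have := Finset.card_lt_card ((hmono b c).ssubset_of_ne fun h => heq h.symm)
          simp only [toList, List.length_cons]
          omega
  have hfin : st (.node .nil U) = st U := by
    rcases hstab .nil U with h | h
    · exact h
    · have hU : st U = U.toList.toFinset := by
        refine Finset.eq_of_subset_of_card_le (fun x hx => ?_) ?_
        · rw [List.mem_toFinset] at hx ⊢
          exact mem_of_mem_lfp hx
        · exact (List.toFinset_card_le _).trans h
      refine Finset.Subset.antisymm (fun x hx => ?_) (hmono _ _)
      rw [hU]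
      simp only [st, List.mem_toFinset] at hx ⊢
      rw [iter, mem_filter] at hx
      exact hx.1
  have : x ∈ st (.node .nil U) := by
    simp only [st, List.mem_toFinset]
    rw [iter, mem_filter]
    exact ⟨hx, h⟩
  rw [hfin] at this
  simpa [st, lfp] using this

end Val

namespace FP

variable {f l : Val → Val}

theorem append {x y : Val → Val} (hx : FP x) (hy : FP y) : FP fun v => Val.append (x v) (y v) := by
  refine FP.listRec id (id.right.left.node id.right.right.right) ?_ hy hx
  refine (id.left.1.add id.right.1).mono fun v => ?_
  exact (size_append_le v.right v.left).trans (by dsimp only; omega)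

theorem bind (hf : FP f) {e : Val → Val} (he : FP e) (hl : FP l) :
    FP fun v => Val.bind f (e v) (l v) := by
  refine FP.listRec nil ((hf.comp (id.left.node id.right.left)).append id.right.right.right) ?_ he hl
  obtain ⟨⟨c, hc⟩, -⟩ := hf
  refine PolyBd.mono ?_ fun v => size_bind_le (m := fun x => (x + 1) ^ c)
    (fun _ _ h => Nat.pow_le_pow_left (by omega) _) hc v.left v.right
  exact (PolyBd.const 1).add (id.right.1.mul
    ((((id.left.1.add id.right.1).add (.const 1)).add (.const 1)).pow c))

theorem filter {φ : Val → Val → Prop} (hφ : DP fun w => φ w.left w.right) (hl : FP l) :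
    FP fun v => Val.filter (φ v) (l v) := by
  simp only [filter_eq_bind φ]
  exact bind (FP.cond hφ (id.right.node nil) nil) id hl

theorem iter {φ : Val → Val → Val → Prop} (hφ : DP fun w => φ w.left.left w.left.right w.right)
    {c : Val → Val} (hl : FP l) (hc : FP c) : FP fun v => Val.iter (φ v) (l v) (c v) := by
  -- The parameter and the universe travel as a pair in the parameter of the recursion.
  have heq : ∀ e U c : Val, Val.iter (φ e) U c = Val.listRec (fun _ => .nil)
      (fun w => Val.filter (fun x => φ w.left.left w.right.right.right x) w.left.right)
      (.node e U) c := by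
    intro e U c
    induction c with
    | nil => rfl
    | node a c _ ih => rw [Val.iter, ih]; rfl
  simp only [heq]
  refine FP.listRec nil (filter (φ := fun w x => φ w.left.left w.right.right.right x) ?_ id.left.right)
    ?_ (id.node hl) hc
  · exact FP.comp hφ (((id.left.left.left).node id.left.right.right.right).node id.right)
  · refine PolyBd.size.mono fun v => ?_
    cases hv : v.right with
    | nil => exact v.size_pos
    | node a c =>
      exact (size_filter_le _ _).trans ((size_right_le v.left).trans v.size_left_le)

theorem lfp {φ : Val → Val → Val → Prop} (hφ : DP fun w => φ w.left.left w.left.right w.right)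
    (hl : FP l) : FP fun v => Val.lfp (φ v) (l v) := iter hφ hl hl

end FP

/-! ### Polynomial-time properties: connectives and bounded quantifiers -/

namespace DP

variable {φ ψ : Val → Prop} {f g : Val → Val}

theorem congr (h : DP φ) (hφψ : ∀ v, φ v ↔ ψ v) : DP ψ := by
  have : φ = ψ := funext fun v => propext (hφψ v)
  exact this ▸ h

theorem comp (h : DP φ) (hf : FP f) : DP fun v => φ (f v) := FP.comp h hf

theorem ne_nil (hf : FP f) : DP fun v => f v ≠ .nil := by
  simp only [DP, cond_ofProp_ne_nil]
  exact hf.cond (.const _) .nil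

theorem eq (hf : FP f) (hg : FP g) : DP fun v => f v = g v := by
  have : FP fun v => ofProp (v.left = v.right) := by
    refine ⟨(PolyBd.const 3).mono fun v => ?_, _,
      ((PolyBd.const 50).mul .size).add (.const 2), Runs.eq⟩
    by_cases h : v.left = v.right
    · simp [ofProp_true h, Val.size]
    · simp [ofProp_false h, Val.size]
  exact this.comp (hf.node hg)

theorem not (h : DP φ) : DP fun v => ¬ φ v := by
  have : FP fun v => Val.cond (ofProp (φ v)) .nil (.node .nil .nil) := FP.cond h .nil (.const _)
  refine (ne_nil this).congr fun v => ?_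
  by_cases hv : φ v
  · rw [ofProp_true hv]; simp [hv, Val.cond]
  · rw [ofProp_false hv]; simp [hv, Val.cond]

theorem and (h : DP φ) (k : DP ψ) : DP fun v => φ v ∧ ψ v := by
  have : FP fun v => Val.cond (ofProp (φ v)) (ofProp (ψ v)) .nil := FP.cond h k .nil
  refine (ne_nil this).congr fun v => ?_
  by_cases hv : φ v
  · rw [ofProp_true hv, Val.cond, ofProp_ne_nil]; simp [hv]
  · rw [ofProp_false hv]; simp [hv, Val.cond]

theorem or (h : DP φ) (k : DP ψ) : DP fun v => φ v ∨ ψ v :=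
  (h.not.and k.not).not.congr fun _ => by tauto

theorem imp (h : DP φ) (k : DP ψ) : DP fun v => φ v → ψ v :=
  (h.and k.not).not.congr fun _ => by tauto

theorem iff (h : DP φ) (k : DP ψ) : DP fun v => (φ v ↔ ψ v) :=
  ((h.imp k).and (k.imp h)).congr fun _ => by tauto

theorem ex {l : Val → Val} {φ : Val → Val → Prop} (hl : FP l) (h : DP fun w => φ w.left w.right) :
    DP fun v => ∃ x ∈ (l v).toList, φ v x := by
  simp only [exists_mem_iff_filter_ne_nil]
  exact ne_nil (FP.filter h hl)

theorem all {l : Val → Val} {φ : Val → Val → Prop} (hl : FP l) (h : DP fun w => φ w.left w.right) :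
    DP fun v => ∀ x ∈ (l v).toList, φ v x :=
  (ex (φ := fun v x => ¬ φ v x) hl h.not).not.congr fun v => by push Not; rfl

theorem mem (hf : FP f) (hg : FP g) : DP fun v => f v ∈ (g v).toList :=
  (ex (φ := fun v x => f v = x) hg (eq (hf.comp FP.id.left) FP.id.right)).congr fun v => by simp

end DP

/-! ### Exponential time -/

namespace Val

/-- The list of all subtrees. -/
def subtrees : Val → Val :=
  treeRec (fun _ => .nil) fun w => .node w.left (append w.right.left w.right.right)

theorem subtrees_node (a b : Val) :
    subtrees (.node a b) = .node (.node a b) (append (subtrees a) (subtrees b)) := rfl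

theorem size_subtrees_le (v : Val) : (subtrees v).size ≤ v.size * (v.size + 1) := by
  induction v with
  | nil => simp [subtrees, treeRec, Val.size]
  | node a b ha hb =>
    rw [subtrees_node]
    have := size_append_le (subtrees a) (subtrees b)
    simp only [Val.size]
    nlinarith [a.size_pos, b.size_pos]

/-- The list of all sublists. -/
def sublists (l : Val) : Val :=
  listRec (fun _ => .node .nil .nil)
    (fun w => append w.right.right.right
      (bind (fun u => .node u .nil) w.right.left w.right.right.right)) .nil l

theorem sublists_node (a l : Val) : sublists (.node a l) =
    append (sublists l) (bind (fun u => .node u .nil) a (sublists l)) := rfl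

theorem size_bind_singleton_le (a l : Val) :
    (bind (fun u => .node u .nil) a l).size ≤ l.size * (a.size + 2) := by
  induction l with
  | nil => rw [bind_nil]; simp only [Val.size]; omega
  | node x l _ ih =>
    rw [bind_node]
    have h := size_append_le (.node (.node a x) .nil) (bind (fun u => .node u .nil) a l)
    simp only [append_node, append_nil, Val.size] at h ⊢
    nlinarith [x.size_pos]

theorem size_sublists_le (l : Val) : (sublists l).size ≤ 2 ^ (l.size + 1) := by
  induction l with
  | nil => simp [sublists, listRec, Val.size]
  | node a l _ ih =>
    rw [sublists_node]
    have h1 := size_append_le (sublists l) (bind (fun u => .node u .nil) a (sublists l))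
    have h2 := size_bind_singleton_le a (sublists l)
    -- Adjoining `a` keeps the old list and adds a copy with `a` in front of each member; this
    -- multiplies the size by at most `a.size + 3`.
    have h3 : ∀ k, 0 < k → k + 3 ≤ 2 ^ (k + 1) := by
      intro k hk
      induction k, hk using Nat.le_induction with
      | base => norm_num
      | succ k _ ih => rw [pow_succ]; omega
    calc _ ≤ (sublists l).size * (a.size + 3) := by linarith
      _ ≤ 2 ^ (l.size + 1) * 2 ^ (a.size + 1) := Nat.mul_le_mul ih (h3 _ a.size_pos)
      _ = _ := by rw [← pow_add]; simp only [Val.size]; congr 1; omega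

theorem mem_of_mem_sublists {l s : Val} (hs : s ∈ (sublists l).toList) :
    ∀ x ∈ s.toList, x ∈ l.toList := by
  induction l generalizing s with
  | nil =>
    obtain rfl : s = .nil := by simpa [sublists, listRec, toList] using hs
    intro x hx
    exact hx
  | node a l _ ih =>
    rw [sublists_node, toList_append, List.mem_append, mem_bind] at hs
    rcases hs with hs | ⟨t, ht, hs⟩
    · exact fun x hx => List.mem_cons_of_mem _ (ih hs x hx)
    · obtain rfl : s = .node a t := by simpa [toList] using hs
      intro x hx
      rcases List.mem_cons.1 hx with rfl | hx
      · exact List.mem_cons_self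
      · exact List.mem_cons_of_mem _ (ih ht x hx)

theorem filter_mem_sublists (φ : Val → Prop) (l : Val) :
    filter φ l ∈ (sublists l).toList := by
  induction l with
  | nil => simp [filter, sublists, listRec, toList]
  | node a l _ ih =>
    rw [sublists_node, toList_append, List.mem_append, mem_bind]
    by_cases h : φ a
    · right
      rw [filter_node_of_pos l h]
      exact ⟨_, ih, by simp [toList]⟩
    · left
      rwa [filter_node_of_neg l h]

end Val

theorem FP.subtrees {f : Val → Val} (hf : FP f) : FP fun v => Val.subtrees (f v) := by
  refine FP.treeRec .nil (id.left.node (id.right.left.append id.right.right)) ?_ hf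
  exact (PolyBd.size.mul (PolyBd.size.add (.const 1))).mono size_subtrees_le

/-- `T` is bounded by an exponential function of a polynomial in the size. -/
def ExpBd (T : Val → ℕ) : Prop := ∃ E, PolyBd E ∧ ∀ v, T v ≤ 2 ^ E v

namespace ExpBd

variable {S T : Val → ℕ}

theorem mono (h : ExpBd T) (hST : ∀ v, S v ≤ T v) : ExpBd S :=
  h.imp fun _ hc => ⟨hc.1, fun v => (hST v).trans (hc.2 v)⟩

theorem two_pow (h : PolyBd T) : ExpBd fun v => 2 ^ T v := ⟨T, h, fun _ => le_rfl⟩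

theorem of_polyBd (h : PolyBd T) : ExpBd T := (two_pow h).mono fun _ => Nat.lt_two_pow_self.le

theorem const (k : ℕ) : ExpBd fun _ => k := of_polyBd (.const k)

theorem mul (hS : ExpBd S) (hT : ExpBd T) : ExpBd fun v => S v * T v := by
  obtain ⟨D, hD, hS⟩ := hS
  obtain ⟨E, hE, hT⟩ := hT
  exact ⟨_, hD.add hE, fun v => by rw [pow_add]; exact Nat.mul_le_mul (hS v) (hT v)⟩

theorem add (hS : ExpBd S) (hT : ExpBd T) : ExpBd fun v => S v + T v := by
  obtain ⟨D, hD, hS⟩ := hS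
  obtain ⟨E, hE, hT⟩ := hT
  refine ⟨_, (hD.add hE).add (.const 1), fun v => ?_⟩
  have h1 : 2 ^ D v ≤ 2 ^ (D v + E v) := Nat.pow_le_pow_right (by omega) (by omega)
  have h2 : 2 ^ E v ≤ 2 ^ (D v + E v) := Nat.pow_le_pow_right (by omega) (by omega)
  have := hS v
  have := hT v
  dsimp only
  rw [pow_succ]
  omega

theorem pow (hT : ExpBd T) (k : ℕ) : ExpBd fun v => T v ^ k := by
  obtain ⟨E, hE, hT⟩ := hT
  exact ⟨_, hE.mul (.const k), fun v => by rw [pow_mul]; exact Nat.pow_le_pow_left (hT v) k⟩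

theorem comp (hT : ExpBd T) {f : Val → Val} (hf : PolyBd fun v => (f v).size) :
    ExpBd fun v => T (f v) := by
  obtain ⟨E, hE, hT⟩ := hT
  exact ⟨_, hE.comp hf, fun v => hT (f v)⟩

end ExpBd

/-- This is the only exponential computation. It is linear recursion with polynomial steps whose
results are exponentially large. -/
theorem runs_sublists : ∃ T, ExpBd T ∧ Runs sublists T := by
  have hs : FP fun w => Val.append w.right.right.right
      (Val.bind (fun u => .node u .nil) w.right.left w.right.right.right) :=
    FP.id.right.right.right.append
      (.bind (FP.id.node .nil) FP.id.right.left FP.id.right.right.right)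
  obtain ⟨-, U, ⟨c, hc⟩, hU⟩ := hs
  have h := Runs.listRec (m := fun x => (x + 1) ^ c) (n := fun x => 2 ^ (x + 1))
    (fun _ _ h => Nat.pow_le_pow_left (by omega) _) (fun _ _ h => Nat.pow_le_pow_right (by omega)
      (by omega)) (Runs.nil.node Runs.nil) hU hc ?_
  · refine ⟨_, ?_, h.comp (Runs.nil.node Runs.id)⟩
    have hw : PolyBd fun v => v.size + 2 := PolyBd.size.add (.const 2)
    have hw' : ExpBd fun v => v.size + 2 := .of_polyBd hw
    refine ((ExpBd.const _).add (ExpBd.comp (f := fun v => .node .nil v) (T := fun w => 1 + 1 + 1 +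
      w.size * ((2 * (w.size + 2) + 2 ^ (w.size + 2 + 1) + 4 + 1) ^ c + 25) + 30) ?_
      (FP.nil.node FP.id).1)).add (.const 1)
    refine ((ExpBd.const _).add ((ExpBd.of_polyBd .size).mul (ExpBd.add ?_ (.const 25)))).add
      (.const 30)
    exact ((((((ExpBd.const 2).mul hw').add (ExpBd.two_pow (hw.add (.const 1)))).add
      (.const 4)).add (.const 1)).pow c)
  -- The recursion never reads its parameter.
  · have henv : ∀ e l : Val, Val.listRec (fun _ => .node .nil .nil)
        (fun w => Val.append w.right.right.right
          (Val.bind (fun u => .node u .nil) w.right.left w.right.right.right)) e l =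
        sublists l := by
      intro e l
      induction l with
      | nil => rfl
      | node a l _ ih => rw [sublists_node, ← ih]; rfl
    intro v
    rw [henv]
    refine (size_sublists_le _).trans (Nat.pow_le_pow_right (by omega) ?_)
    have := v.size_right_le
    omega

/-- A property that is decidable in polynomial time, given the list of all sublists of a list that
is computable in polynomial time, is decidable in exponential time. -/
theorem decidableInExpTime_of_sublists {I : Type} {encode : I → Val} {promise answer : I → Prop}
    {ψ : Val → Prop} {l : Val → Val} (hψ : DP ψ) (hl : FP l)
    (h : ∀ i, promise i → (ψ (.node (encode i) (sublists (l (encode i)))) ↔ answer i)) :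
    DecidableInExpTime encode promise answer := by
  obtain ⟨T, hT, hs⟩ := runs_sublists
  obtain ⟨-, U, ⟨c, hU⟩, hψ⟩ := hψ
  obtain ⟨hl1, V, hV, hl⟩ := hl
  have hrun := hψ.comp (Runs.id.node (hs.comp hl))
  have hbd : ExpBd fun v => 1 + (V v + T (l v) + 1) + 1 + U (.node v (sublists (l v))) + 1 := by
    refine ((((ExpBd.const 1).add (((ExpBd.of_polyBd hV).add (hT.comp hl1)).add (.const 1))).add
      (.const 1)).add (ExpBd.mono ?_ fun v => hU _)).add (.const 1)
    refine ((((ExpBd.of_polyBd .size).add (ExpBd.mono (ExpBd.two_pow (hl1.add (.const 1)))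
      fun v => size_sublists_le (l v))).add (.const 1)).add (.const 1)).pow c
  -- The main expression occupies position `0` of the program, so the auxiliary block starts at
  -- position `1`.
  obtain ⟨B, e, hrun⟩ := hrun 1
  obtain ⟨E, ⟨d, hE⟩, hbd⟩ := hbd
  refine ⟨e :: B, (Polynomial.X + 1) ^ d, fun i hi => ?_⟩
  obtain ⟨t, ht, hev⟩ := hrun [e] [] rfl (encode i) []
  refine ⟨_, t, by simpa using hev, ?_, ?_⟩
  · refine (ht.trans (hbd _)).trans (Nat.pow_le_pow_right (by omega) ?_)
    simpa using hE (encode i)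
  · rw [ofProp_ne_nil, h i hi]

/-! ### The algorithm -/

namespace Val

theorem self_mem_subtrees {v : Val} (h : v ≠ .nil) : v ∈ (subtrees v).toList := by
  cases v with
  | nil => exact (h rfl).elim
  | node a b => simp [subtrees_node, toList]

theorem mem_subtrees_trans {u v w : Val} (h : v ∈ (subtrees w).toList)
    (hu : u ∈ (subtrees v).toList) : u ∈ (subtrees w).toList := by
  induction w with
  | nil => simp [subtrees, treeRec, toList] at h
  | node a b ha hb =>
    rw [subtrees_node, toList, List.mem_cons, toList_append, List.mem_append] at h ⊢
    rcases h with rfl | h | h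
    · rwa [subtrees_node, toList, List.mem_cons, toList_append, List.mem_append] at hu
    · exact .inr (.inl (ha h))
    · exact .inr (.inr (hb h))

theorem left_mem_subtrees {a b : Val} (h : a ≠ .nil) : a ∈ (subtrees (.node a b)).toList := by
  simp [subtrees_node, toList, toList_append, self_mem_subtrees h]

theorem right_mem_subtrees {a b : Val} (h : b ≠ .nil) : b ∈ (subtrees (.node a b)).toList := by
  simp [subtrees_node, toList, toList_append, self_mem_subtrees h]

theorem mem_subtrees_of_mem_toList {x l : Val} (hx : x ≠ .nil) (h : x ∈ l.toList) :
    x ∈ (subtrees l).toList := by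
  induction l with
  | nil => simp [toList] at h
  | node a l _ ih =>
    rcases List.mem_cons.1 h with rfl | h
    · exact left_mem_subtrees hx
    · have : l ≠ .nil := by
        rintro rfl
        simp [toList] at h
      exact mem_subtrees_trans (right_mem_subtrees this) (ih h)

/-- The list of the pairs of members of a list. -/
def pairs (l : Val) : Val :=
  bind (fun w => bind (fun u => .node u .nil) w.right w.left) l l

theorem mem_pairs {l x : Val} :
    x ∈ (pairs l).toList ↔ ∃ a ∈ l.toList, ∃ b ∈ l.toList, x = .node a b := by
  simp [pairs, mem_bind, toList, Val.left, Val.right]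

/-- The encoding of the variables with an index below a given number. -/
def vars (n : Val) : Val :=
  listRec (fun _ => .nil) (fun w => .node (.node .nil w.right.right.left) w.right.right.right) .nil n

theorem vars_node (a l : Val) : vars (.node a l) = .node (.node .nil l) (vars l) := rfl

/-- Inclusion of lists, as sets. -/
def Incl (x y : Val) : Prop := ∀ z ∈ x.toList, z ∈ y.toList

/-- The encoding of a join. -/
def join (a b : Val) : Val := .node (encodeNat 1) (.node a b)

/-- The encoding of a meet. -/
def meet (a b : Val) : Val := .node (encodeNat 2) (.node a b)

end Val

/-- One step of the computation of the subterms of the terms in an encoded input. -/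
def subtermStep (v st x : Val) : Prop :=
  (x ∈ v.right.toList ∨ ∃ r ∈ v.left.right.toList, x = r.left ∨ x = r.right) ∨
    ∃ y ∈ st.toList, y.left ≠ .nil ∧ (x = y.right.left ∨ x = y.right.right)

/-- The list of the variables and of the subterms of the terms in an encoded input. -/
noncomputable def termList (v : Val) : Val :=
  append (vars v.left.left) (lfp (subtermStep v) (subtrees v))

/-- One step of the computation of the order of the terms in an encoded input. -/
def orderStep (v st p q : Val) : Prop :=
  p = q ∨
  (∃ r ∈ (termList v).toList, .node p r ∈ st.toList ∧ .node r q ∈ st.toList) ∨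
  (p = meet q p.right.right ∨ p = meet p.right.left q) ∨
  (q = meet q.right.left q.right.right ∧
    .node p q.right.left ∈ st.toList ∧ .node p q.right.right ∈ st.toList) ∨
  (q = join p q.right.right ∨ q = join q.right.left p) ∨
  (p = join p.right.left p.right.right ∧
    .node p.right.left q ∈ st.toList ∧ .node p.right.right q ∈ st.toList) ∨
  (.node p q ∈ v.left.right.toList ∨ .node q p ∈ v.left.right.toList)

/-- The list of the pairs of terms in an encoded input that are in order. -/
noncomputable def orderList (v : Val) : Val :=
  lfp (fun st x => orderStep v st x.left x.right) (pairs (termList v))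

/-- The list `l` represents an ideal of terms. -/
def IdealTest (v l : Val) : Prop :=
  (∀ q ∈ l.toList, ∀ p ∈ (termList v).toList, .node p q ∈ (orderList v).toList → p ∈ l.toList) ∧
  ∀ a ∈ l.toList, ∀ b ∈ l.toList, join a b ∈ (termList v).toList → join a b ∈ l.toList

/-- The list of the ideals of terms; the right part of `w` is the list of all sets of terms. -/
noncomputable def idealList (w : Val) : Val := filter (IdealTest w.left) w.right

/-- The list `l` represents the principal ideal of `x`. -/
def PrincipalTest (v l x : Val) : Prop :=
  ∀ p ∈ (termList v).toList, p ∈ l.toList ↔ .node p x ∈ (orderList v).toList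

/-- One step of the computation of the generated sublattice of the lattice of ideals. -/
def sublatticeStep (w st l : Val) : Prop :=
  (∃ x ∈ w.left.right.toList, PrincipalTest w.left l x) ∨
  ∃ j ∈ st.toList, ∃ k ∈ st.toList,
    (∀ p ∈ (termList w.left).toList, p ∈ l.toList ↔ p ∈ j.toList ∧ p ∈ k.toList) ∨
    (Incl j l ∧ Incl k l ∧ ∀ m ∈ (idealList w).toList, Incl j m → Incl k m → Incl l m)

/-- The generated sublattice of the lattice of ideals. -/
noncomputable def sublatticeList (w : Val) : Val := lfp (sublatticeStep w) (idealList w)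

/-- One step of the computation of the good elements of a lattice of sets that is given by the list
`U`. -/
def goodStep (U st s : Val) : Prop :=
  ∀ u ∈ U.toList, ∀ v ∈ U.toList, (∀ z ∈ U.toList, Incl u z → Incl v z → Incl s z) →
    Incl s u ∨ Incl s v ∨
      ∀ z ∈ U.toList, (∀ c ∈ st.toList, Incl c u ∨ Incl c v → Incl c z) → Incl s z

/-- The list of the good elements. -/
noncomputable def goodList (U : Val) : Val := lfp (goodStep U) U

/-- The final test of the algorithm. -/
def AllGood (w : Val) : Prop :=
  ∀ x ∈ w.left.right.toList, ∃ l ∈ (goodList (sublatticeList w)).toList, PrincipalTest w.left l x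

/-! ### The algorithm takes polynomial time, given the list of the sets of terms -/

section Time

variable {f g h : Val → Val}

theorem FP.vars (hf : FP f) : FP fun v => Val.vars (f v) := by
  refine FP.listRec .nil ((FP.nil.node id.right.right.left).node id.right.right.right) ?_ .nil hf
  refine (PolyBd.size.mul (PolyBd.size.add (.const 3))).mono fun v => ?_
  have : ∀ e l : Val, (Val.listRec (fun _ => .nil)
      (fun w => .node (.node .nil w.right.right.left) w.right.right.right) e l).size ≤
      l.size * (l.size + 3) := by
    intro e l
    induction l with
    | nil => simp [Val.listRec, Val.size]
    | node a l _ ih =>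
      simp only [Val.listRec, Val.right, Val.left, Val.size] at ih ⊢
      nlinarith [a.size_pos, l.size_pos]
  have h := v.size_right_le
  exact (this v.left v.right).trans (Nat.mul_le_mul h (by omega))

theorem FP.pairs (hf : FP f) : FP fun v => Val.pairs (f v) :=
  .bind (.bind (FP.id.node .nil) FP.id.right FP.id.left) hf hf

theorem DP.incl (hf : FP f) (hg : FP g) : DP fun v => Incl (f v) (g v) :=
  DP.all (φ := fun v x => x ∈ (g v).toList) hf (.mem FP.id.right (hg.comp FP.id.left))

theorem FP.termList (hf : FP f) : FP fun v => LatDec.termList (f v) := by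
  suffices FP fun v => LatDec.termList v from this.comp hf
  refine FP.append (FP.vars FP.id.left.left) (FP.lfp (φ := subtermStep) ?_ (FP.subtrees FP.id))
  unfold subtermStep
  -- The formula is composed of polynomial-time functions, connectives and quantifiers bounded by
  -- lists, and the closure rules follow its syntax.
  repeat' first
    | exact FP.id | exact FP.nil | apply FP.left | apply FP.right
    | apply DP.ex | apply DP.or | apply DP.and | apply DP.ne_nil | apply DP.mem | apply DP.eq

theorem FP.orderList (hf : FP f) : FP fun v => LatDec.orderList (f v) := by
  suffices FP fun v => LatDec.orderList v from this.comp hf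
  refine FP.lfp (φ := fun v st x => orderStep v st x.left x.right) ?_ (FP.pairs (FP.termList FP.id))
  unfold orderStep Val.join Val.meet
  repeat' first
    | exact FP.id | apply FP.left | apply FP.right | apply FP.const | apply FP.node
    | apply FP.termList
    | apply DP.ex | apply DP.or | apply DP.and | apply DP.mem | apply DP.eq

theorem FP.idealList (hf : FP f) : FP fun v => LatDec.idealList (f v) := by
  suffices FP fun v => LatDec.idealList v from this.comp hf
  refine FP.filter (φ := fun w l => IdealTest w.left l) ?_ FP.id.right
  unfold IdealTest Val.join
  repeat' first
    | exact FP.id | apply FP.left | apply FP.right | apply FP.const | apply FP.node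
    | apply FP.termList | apply FP.orderList
    | apply DP.all | apply DP.and | apply DP.imp | apply DP.mem

theorem DP.principalTest (hf : FP f) (hg : FP g) (hh : FP h) :
    DP fun v => PrincipalTest (f v) (g v) (h v) := by
  suffices DP fun v => PrincipalTest v.left v.right.left v.right.right from
    this.comp (hf.node (hg.node hh))
  unfold PrincipalTest
  repeat' first
    | exact FP.id | apply FP.left | apply FP.right | apply FP.node
    | apply FP.termList | apply FP.orderList
    | apply DP.all | apply DP.iff | apply DP.mem

theorem FP.sublatticeList (hf : FP f) : FP fun v => LatDec.sublatticeList (f v) := by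
  suffices FP fun v => LatDec.sublatticeList v from this.comp hf
  refine FP.lfp (φ := sublatticeStep) ?_ (FP.idealList FP.id)
  unfold sublatticeStep
  repeat' first
    | exact FP.id | apply FP.left | apply FP.right | apply FP.node
    | apply FP.termList | apply FP.idealList | apply DP.principalTest | apply DP.incl
    | apply DP.all | apply DP.ex | apply DP.and | apply DP.or | apply DP.iff | apply DP.imp
    | apply DP.mem

theorem FP.goodList (hf : FP f) : FP fun v => LatDec.goodList (f v) := by
  suffices FP fun v => LatDec.goodList v from this.comp hf
  refine FP.lfp (φ := goodStep) ?_ FP.id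
  unfold goodStep
  repeat' first
    | exact FP.id | apply FP.left | apply FP.right | apply DP.incl
    | apply DP.all | apply DP.or | apply DP.imp

theorem DP.allGood (hf : FP f) : DP fun v => AllGood (f v) := by
  suffices DP fun v => AllGood v from this.comp hf
  unfold AllGood
  repeat' first
    | exact FP.id | apply FP.left | apply FP.right | apply FP.sublatticeList | apply FP.goodList
    | apply DP.principalTest | apply DP.all | apply DP.ex

end Time

/-! ### Correctness of the algorithm -/

theorem encodeNat_injective : Function.Injective encodeNat := by
  intro m
  induction m with
  | zero => intro k h; cases k <;> simp_all [encodeNat]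
  | succ m ih =>
    intro k h
    cases k with
    | zero => simp [encodeNat] at h
    | succ k => rw [ih (Val.node.inj h).2]

theorem encodeTerm_sup {n : ℕ} (s t : Term (Fin n)) :
    encodeTerm (.sup s t) = join (encodeTerm s) (encodeTerm t) := rfl

theorem encodeTerm_injective {n : ℕ} : Function.Injective (encodeTerm (n := n)) := by
  intro s
  induction s with
  | var i =>
    intro t h
    cases t with
    | var j => simp only [encodeTerm, Val.node.injEq, true_and] at h
               rw [Fin.ext (encodeNat_injective h)]
    | sup _ _ => simp [encodeTerm, encodeNat] at h
    | inf _ _ => simp [encodeTerm, encodeNat] at h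
  | sup a b ha hb =>
    intro t h
    cases t with
    | var j => simp [encodeTerm, encodeNat] at h
    | sup c d =>
      simp only [encodeTerm, Val.node.injEq, true_and] at h
      rw [ha h.1, hb h.2]
    | inf _ _ => simp [encodeTerm, encodeNat] at h
  | inf a b ha hb =>
    intro t h
    cases t with
    | var j => simp [encodeTerm, encodeNat] at h
    | sup _ _ => simp [encodeTerm, encodeNat] at h
    | inf c d =>
      simp only [encodeTerm, Val.node.injEq, true_and] at h
      rw [ha h.1, hb h.2]

theorem encodeTerm_ne_nil {n : ℕ} (t : Term (Fin n)) : encodeTerm t ≠ .nil := by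
  cases t <;> simp [encodeTerm]

theorem encodeTerm_eq_join {n : ℕ} {t : Term (Fin n)} {a b : Val} (h : encodeTerm t = join a b) :
    ∃ s u, t = .sup s u ∧ a = encodeTerm s ∧ b = encodeTerm u := by
  cases t with
  | var i => simp [encodeTerm, encodeNat, join] at h
  | sup s u =>
    simp only [encodeTerm, join, Val.node.injEq, true_and] at h
    exact ⟨s, u, rfl, h.1.symm, h.2.symm⟩
  | inf s u => simp [encodeTerm, encodeNat, join] at h

theorem encodeTerm_eq_meet {n : ℕ} {t : Term (Fin n)} {a b : Val} (h : encodeTerm t = meet a b) :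
    ∃ s u, t = .inf s u ∧ a = encodeTerm s ∧ b = encodeTerm u := by
  cases t with
  | var i => simp [encodeTerm, encodeNat, meet] at h
  | inf s u =>
    simp only [encodeTerm, meet, Val.node.injEq, true_and] at h
    exact ⟨s, u, rfl, h.1.symm, h.2.symm⟩
  | sup s u => simp [encodeTerm, encodeNat, meet] at h

theorem toList_encodeList {α : Type} (enc : α → Val) (l : List α) :
    (encodeList enc l).toList = l.map enc := by
  induction l with
  | nil => rfl
  | cons a l ih => rw [encodeList, toList, ih, List.map_cons]

/-- This turns a computed list back into a list of terms. -/
theorem exists_encodeList {α : Type} {enc : α → Val} {v : Val}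
    (h : ∀ x ∈ v.toList, ∃ a, x = enc a) : ∃ l : List α, v = encodeList enc l := by
  induction v with
  | nil => exact ⟨[], rfl⟩
  | node a v _ ih =>
    obtain ⟨b, rfl⟩ := h a List.mem_cons_self
    obtain ⟨l, rfl⟩ := ih fun x hx => h x (List.mem_cons_of_mem _ hx)
    exact ⟨b :: l, rfl⟩

theorem mem_vars {n : ℕ} {x : Val} :
    x ∈ (vars (encodeNat n)).toList ↔ ∃ i < n, x = .node .nil (encodeNat i) := by
  induction n with
  | zero => simp [vars, encodeNat, listRec, toList]
  | succ n ih =>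
    rw [encodeNat, vars_node, toList, List.mem_cons, ih]
    constructor
    · rintro (rfl | ⟨i, hi, rfl⟩)
      · exact ⟨n, by omega, rfl⟩
      · exact ⟨i, by omega, rfl⟩
    · rintro ⟨i, hi, rfl⟩
      rcases Nat.lt_succ_iff_lt_or_eq.1 hi with h | rfl
      · exact .inr ⟨i, h, rfl⟩
      · exact .inl rfl

/-! ### The computed terms, order, ideals and sublattice -/

namespace SubPres

variable (Q : SubPres)

/-- The terms that occur in the relations and in the list of generators. -/
def roots : Set (Term (Fin Q.pres.n)) := Q.pres.sides ∪ {t | t ∈ Q.gens}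

/-- The variables and the subterms of the terms that occur in the input. -/
def terms : Set (Term (Fin Q.pres.n)) := termClosure Q.roots

theorem mem_encode_right {x : Val} :
    x ∈ Q.encode.right.toList ↔ ∃ t ∈ Q.gens, x = encodeTerm t := by
  simp [SubPres.encode, Val.right, toList_encodeList, eq_comm]

theorem mem_encode_rels {x : Val} : x ∈ Q.encode.left.right.toList ↔
    ∃ r ∈ Q.pres.rels, x = .node (encodeTerm r.1) (encodeTerm r.2) := by
  simp [SubPres.encode, FinPres.encode, Val.right, Val.left, toList_encodeList, eq_comm]

theorem root_iff {x : Val} :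
    (x ∈ Q.encode.right.toList ∨ ∃ r ∈ Q.encode.left.right.toList, x = r.left ∨ x = r.right) ↔
      ∃ t ∈ Q.roots, x = encodeTerm t := by
  simp only [mem_encode_right, mem_encode_rels]
  constructor
  · rintro (⟨t, ht, rfl⟩ | ⟨_, ⟨r, hr, rfl⟩, rfl | rfl⟩)
    · exact ⟨t, .inr ht, rfl⟩
    · exact ⟨r.1, .inl ⟨r, hr, .inl rfl⟩, rfl⟩
    · exact ⟨r.2, .inl ⟨r, hr, .inr rfl⟩, rfl⟩
  · rintro ⟨t, ⟨r, hr, rfl | rfl⟩ | ht, rfl⟩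
    · exact .inr ⟨_, ⟨r, hr, rfl⟩, .inl rfl⟩
    · exact .inr ⟨_, ⟨r, hr, rfl⟩, .inr rfl⟩
    · exact .inl ⟨t, ht, rfl⟩

theorem subtermStep_mono (v : Val) : MonoOp (subtermStep v) := by
  intro s t x hst
  exact Or.imp_right fun ⟨y, hy, h⟩ => ⟨y, hst y hy, h⟩

theorem root_mem_subtrees {t : Term (Fin Q.pres.n)} (ht : t ∈ Q.roots) :
    encodeTerm t ∈ (subtrees Q.encode).toList := by
  have h0 := encodeTerm_ne_nil t
  have hQ : Q.encode = .node (.node (encodeNat Q.pres.n) Q.encode.left.right) Q.encode.right := rfl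
  have hne : ∀ {x l : Val}, x ∈ l.toList → l ≠ .nil := by
    rintro x l h rfl
    simp [toList] at h
  rcases (Q.root_iff).2 ⟨t, ht, rfl⟩ with h | ⟨r, hr, h⟩
  · rw [hQ]
    exact mem_subtrees_trans (right_mem_subtrees (hne h)) (mem_subtrees_of_mem_toList h0 h)
  · obtain ⟨r', -, rfl⟩ := Q.mem_encode_rels.1 hr
    have h1 := mem_subtrees_of_mem_toList (by simp) hr
    have h2 : encodeTerm t ∈ (subtrees Q.encode.left.right).toList := by
      refine mem_subtrees_trans h1 ?_
      rcases h with h | h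
      · rw [h]; exact left_mem_subtrees (encodeTerm_ne_nil _)
      · rw [h]; exact right_mem_subtrees (encodeTerm_ne_nil _)
    rw [hQ]
    refine mem_subtrees_trans (left_mem_subtrees (by simp)) ?_
    exact mem_subtrees_trans (right_mem_subtrees (hne hr)) h2

/-- The tag `c` is arbitrary, so that joins and meets are both covered. -/
theorem mem_subtrees_of_sup {n : ℕ} {s t : Term (Fin n)} {u : Val} (c : Val)
    (h : .node c (.node (encodeTerm s) (encodeTerm t)) ∈ (subtrees u).toList) :
    encodeTerm s ∈ (subtrees u).toList ∧ encodeTerm t ∈ (subtrees u).toList := by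
  have := mem_subtrees_trans h (right_mem_subtrees (by simp))
  exact ⟨mem_subtrees_trans this (left_mem_subtrees (encodeTerm_ne_nil s)),
    mem_subtrees_trans this (right_mem_subtrees (encodeTerm_ne_nil t))⟩

/-- The fixed point is taken inside the list of subtrees of the input. Nothing is lost, since
encodings of subterms are subtrees. -/
theorem mem_termList {x : Val} :
    x ∈ (termList Q.encode).toList ↔ ∃ t ∈ Q.terms, x = encodeTerm t := by
  have hn : Q.encode.left.left = encodeNat Q.pres.n := rfl
  rw [termList, toList_append, List.mem_append, hn, mem_vars]
  constructor
  · rintro (⟨i, hi, rfl⟩ | h)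
    · exact ⟨.var ⟨i, hi⟩, .inl ⟨_, rfl⟩, rfl⟩
    · refine lfp_induction (Q := fun x => ∃ t ∈ Q.terms, x = encodeTerm t) h fun s x hs _ hx => ?_
      rcases hx with hx | ⟨y, hy, hy0, hx⟩
      · obtain ⟨t, ht, rfl⟩ := Q.root_iff.1 hx
        exact ⟨t, subset_termClosure _ ht, rfl⟩
      · obtain ⟨⟨t, ht, rfl⟩, -⟩ := hs y hy
        cases t with
        -- The tag of a variable is `encodeNat 0 = nil`, so the search never descends into an index.
        | var i => exact (hy0 rfl).elim
        | sup s t =>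
          obtain ⟨h1, h2⟩ := of_sup_mem_termClosure ht
          rcases hx with rfl | rfl
          · exact ⟨s, h1, rfl⟩
          · exact ⟨t, h2, rfl⟩
        | inf s t =>
          obtain ⟨h1, h2⟩ := of_inf_mem_termClosure ht
          rcases hx with rfl | rfl
          · exact ⟨s, h1, rfl⟩
          · exact ⟨t, h2, rfl⟩
  · rintro ⟨t, ⟨i, rfl⟩ | ⟨u, hu, htu⟩, rfl⟩
    · exact .inl ⟨i, i.2, rfl⟩
    · right
      have key : ∀ u : Term (Fin Q.pres.n),
          encodeTerm u ∈ (lfp (subtermStep Q.encode) (subtrees Q.encode)).toList →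
          ∀ t ∈ u.subterms,
            encodeTerm t ∈ (lfp (subtermStep Q.encode) (subtrees Q.encode)).toList := by
        intro u
        induction u with
        | var i =>
          intro h t ht
          obtain rfl : t = .var i := ht
          exact h
        | sup p q hp hq =>
          intro h t ht
          obtain ⟨h1, h2⟩ := mem_subtrees_of_sup _ (mem_of_mem_lfp h)
          rcases ht with ht | ht | ht
          · obtain rfl : t = .sup p q := ht
            exact h
          · exact hp (mem_lfp (subtermStep_mono _) h1
              (.inr ⟨_, h, by simp [encodeTerm, encodeNat, Val.left], .inl rfl⟩)) t ht
          · exact hq (mem_lfp (subtermStep_mono _) h2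
              (.inr ⟨_, h, by simp [encodeTerm, encodeNat, Val.left], .inr rfl⟩)) t ht
        | inf p q hp hq =>
          intro h t ht
          obtain ⟨h1, h2⟩ := mem_subtrees_of_sup _ (mem_of_mem_lfp h)
          rcases ht with ht | ht | ht
          · obtain rfl : t = .inf p q := ht
            exact h
          · exact hp (mem_lfp (subtermStep_mono _) h1
              (.inr ⟨_, h, by simp [encodeTerm, encodeNat, Val.left], .inl rfl⟩)) t ht
          · exact hq (mem_lfp (subtermStep_mono _) h2
              (.inr ⟨_, h, by simp [encodeTerm, encodeNat, Val.left], .inr rfl⟩)) t ht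
      exact key u (mem_lfp (subtermStep_mono _) (Q.root_mem_subtrees hu)
        (.inl (Q.root_iff.2 ⟨u, hu, rfl⟩))) t htu

theorem encodeTerm_mem_termList {t : Term (Fin Q.pres.n)} :
    encodeTerm t ∈ (termList Q.encode).toList ↔ t ∈ Q.terms := by
  rw [mem_termList]
  exact ⟨fun ⟨s, hs, h⟩ => encodeTerm_injective h ▸ hs, fun h => ⟨t, h, rfl⟩⟩

theorem orderStep_mono (v : Val) : MonoOp (fun st x => orderStep v st x.left x.right) := by
  intro s t x hst
  rintro (h | ⟨r, hr, h1, h2⟩ | h | ⟨h, h1, h2⟩ | h | ⟨h, h1, h2⟩ | h)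
  · exact .inl h
  · exact .inr (.inl ⟨r, hr, hst _ h1, hst _ h2⟩)
  · exact .inr (.inr (.inl h))
  · exact .inr (.inr (.inr (.inl ⟨h, hst _ h1, hst _ h2⟩)))
  · exact .inr (.inr (.inr (.inr (.inl h))))
  · exact .inr (.inr (.inr (.inr (.inr (.inl ⟨h, hst _ h1, hst _ h2⟩)))))
  · exact .inr (.inr (.inr (.inr (.inr (.inr h)))))

/-- The order of terms that the algorithm computes. -/
def Order (s t : Term (Fin Q.pres.n)) : Prop :=
  .node (encodeTerm s) (encodeTerm t) ∈ (orderList Q.encode).toList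

theorem order_of_step {s t : Term (Fin Q.pres.n)} (hs : s ∈ Q.terms) (ht : t ∈ Q.terms)
    (h : orderStep Q.encode (orderList Q.encode) (encodeTerm s) (encodeTerm t)) :
    Q.Order s t :=
  mem_lfp (orderStep_mono _) (mem_pairs.2 ⟨_, Q.encodeTerm_mem_termList.2 hs, _,
    Q.encodeTerm_mem_termList.2 ht, rfl⟩) h

theorem roots_rel : ∀ r ∈ Q.pres.relSet, r.1 ∈ Q.roots ∧ r.2 ∈ Q.roots := fun r hr =>
  ⟨.inl (Q.pres.mem_sides r hr).1, .inl (Q.pres.mem_sides r hr).2⟩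

theorem terms_finite : Q.terms.Finite :=
  termClosure_finite (Q.pres.sides_finite.union Q.gens.finite_toSet)

theorem gens_subset {t : Term (Fin Q.pres.n)} (h : t ∈ Q.gens) : t ∈ Q.terms :=
  subset_termClosure _ (.inr h)

theorem saturated : Saturated Q.pres.relSet Q.terms (TermLE Q.pres.relSet) :=
  saturated_termLE Q.roots_rel

/-- Each rule is one disjunct of `orderStep`, under which the fixed point is closed. -/
theorem saturated_order : Saturated Q.pres.relSet Q.terms Q.Order where
  var_mem := Q.saturated.var_mem
  of_sup := Q.saturated.of_sup
  of_inf := Q.saturated.of_inf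
  rel_mem := Q.saturated.rel_mem
  refl _ hs := Q.order_of_step hs hs (.inl rfl)
  trans _ hs _ ht _ hu h k := Q.order_of_step hs hu
    (.inr (.inl ⟨_, Q.encodeTerm_mem_termList.2 ht, h, k⟩))
  inf_left h := Q.order_of_step h (Q.saturated.of_inf h).1 (.inr (.inr (.inl (.inl rfl))))
  inf_right h := Q.order_of_step h (Q.saturated.of_inf h).2 (.inr (.inr (.inl (.inr rfl))))
  le_inf _ hu h h1 h2 := Q.order_of_step hu h (.inr (.inr (.inr (.inl ⟨rfl, h1, h2⟩))))
  left_sup h := Q.order_of_step (Q.saturated.of_sup h).1 h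
    (.inr (.inr (.inr (.inr (.inl (.inl rfl))))))
  right_sup h := Q.order_of_step (Q.saturated.of_sup h).2 h
    (.inr (.inr (.inr (.inr (.inl (.inr rfl))))))
  sup_le _ hu h h1 h2 := Q.order_of_step h hu
    (.inr (.inr (.inr (.inr (.inr (.inl ⟨rfl, h1, h2⟩))))))
  rel_le r hr := Q.order_of_step (Q.saturated.rel_mem r hr).1 (Q.saturated.rel_mem r hr).2
    (.inr (.inr (.inr (.inr (.inr (.inr (.inl (Q.mem_encode_rels.2 ⟨r, hr, rfl⟩))))))))
  rel_ge r hr := Q.order_of_step (Q.saturated.rel_mem r hr).2 (Q.saturated.rel_mem r hr).1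
    (.inr (.inr (.inr (.inr (.inr (.inr (.inr (Q.mem_encode_rels.2 ⟨r, hr, rfl⟩))))))))

theorem termLE_of_mem_orderList {x : Val} (hx : x ∈ (orderList Q.encode).toList) :
    ∃ s ∈ Q.terms, ∃ t ∈ Q.terms, x = .node (encodeTerm s) (encodeTerm t) ∧
      TermLE Q.pres.relSet s t := by
  refine lfp_induction (Q := fun x => ∃ s ∈ Q.terms, ∃ t ∈ Q.terms,
    x = .node (encodeTerm s) (encodeTerm t) ∧ TermLE Q.pres.relSet s t) hx fun st x hst hx h => ?_
  obtain ⟨_, ha, _, hb, rfl⟩ := mem_pairs.1 hx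
  obtain ⟨p, hp, rfl⟩ := Q.mem_termList.1 ha
  obtain ⟨q, hq, rfl⟩ := Q.mem_termList.1 hb
  refine ⟨p, hp, q, hq, rfl, ?_⟩
  have key : ∀ {s t : Term (Fin Q.pres.n)}, .node (encodeTerm s) (encodeTerm t) ∈ st.toList →
      TermLE Q.pres.relSet s t := by
    intro s t h
    obtain ⟨⟨s', -, t', -, h1, h2⟩, -⟩ := hst _ h
    obtain ⟨h3, h4⟩ := Val.node.inj h1
    rwa [encodeTerm_injective h3, encodeTerm_injective h4]
  dsimp only [Val.left, Val.right] at h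
  rcases h with h | ⟨r, hr, h1, h2⟩ | h | ⟨h, h1, h2⟩ | h | ⟨h, h1, h2⟩ | h
  · rw [encodeTerm_injective h]; exact .refl _
  · obtain ⟨r, -, rfl⟩ := Q.mem_termList.1 hr
    exact (key h1).trans (key h2)
  · rcases h with h | h
    · obtain ⟨s, u, rfl, h1, h2⟩ := encodeTerm_eq_meet h
      rw [encodeTerm_injective h1]; exact .inf_left _ _
    · obtain ⟨s, u, rfl, h1, h2⟩ := encodeTerm_eq_meet h
      rw [encodeTerm_injective h2]; exact .inf_right _ _
  · obtain ⟨s, u, rfl, h3, h4⟩ := encodeTerm_eq_meet h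
    exact .le_inf (key h1) (key h2)
  · rcases h with h | h
    · obtain ⟨s, u, rfl, h1, h2⟩ := encodeTerm_eq_join h
      rw [encodeTerm_injective h1]; exact .left_sup _ _
    · obtain ⟨s, u, rfl, h1, h2⟩ := encodeTerm_eq_join h
      rw [encodeTerm_injective h2]; exact .right_sup _ _
  · obtain ⟨s, u, rfl, h3, h4⟩ := encodeTerm_eq_join h
    exact .sup_le (key h1) (key h2)
  · rcases h with h | h
    · obtain ⟨r, hr, h⟩ := Q.mem_encode_rels.1 h
      obtain ⟨h3, h4⟩ := Val.node.inj h
      rw [encodeTerm_injective h3, encodeTerm_injective h4]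
      exact .rel_le hr
    · obtain ⟨r, hr, h⟩ := Q.mem_encode_rels.1 h
      obtain ⟨h3, h4⟩ := Val.node.inj h
      rw [encodeTerm_injective h3, encodeTerm_injective h4]
      exact .rel_ge hr

theorem Order.termLE {s t : Term (Fin Q.pres.n)} (h : Q.Order s t) : TermLE Q.pres.relSet s t := by
  obtain ⟨s', -, t', -, h1, h2⟩ := Q.termLE_of_mem_orderList h
  obtain ⟨h3, h4⟩ := Val.node.inj h1
  rwa [encodeTerm_injective h3, encodeTerm_injective h4]

/-- Soundness is induction along the computation. Completeness holds although only terms of the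
input are used: the computed relation is saturated, so its ideals give a lattice satisfying the
relations in which every underivable inequality fails. -/
theorem order_iff {s t : Term (Fin Q.pres.n)} (hs : s ∈ Q.terms) (ht : t ∈ Q.terms) :
    Q.Order s t ↔ TermLE Q.pres.relSet s t :=
  ⟨Order.termLE Q, TermIdeal.rel_of_termLE Q.saturated_order (fun _ _ _ _ h => h.termLE) hs ht⟩

/-- The lattice of ideals of the terms that occur in the input. -/
abbrev Ideals : Type := TermIdeal Q.terms (TermLE Q.pres.relSet)

/-- The set of terms that a list represents. -/
def den (l : Val) : Set (Term (Fin Q.pres.n)) := {t | encodeTerm t ∈ l.toList}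

/-- The input of the final test. -/
noncomputable def expanded : Val := .node Q.encode (sublists (termList Q.encode))

theorem exists_of_mem_sublists {l : Val} (hl : l ∈ (sublists (termList Q.encode)).toList) {x : Val}
    (hx : x ∈ l.toList) : ∃ t ∈ Q.terms, x = encodeTerm t :=
  Q.mem_termList.1 (mem_of_mem_sublists hl x hx)

theorem mem_idealList {l : Val} : l ∈ (idealList Q.expanded).toList ↔
    l ∈ (sublists (termList Q.encode)).toList ∧
      IsTermIdeal Q.terms (TermLE Q.pres.relSet) (Q.den l) := by
  rw [idealList, mem_filter]
  refine and_congr_right fun hl => ?_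
  have hl' : ∀ {x}, x ∈ l.toList → ∃ t ∈ Q.terms, x = encodeTerm t :=
    fun hx => Q.exists_of_mem_sublists hl hx
  have hden : ∀ {t}, t ∈ Q.den l → t ∈ Q.terms := by
    intro t ht
    obtain ⟨s, hs, h⟩ := hl' ht
    rwa [encodeTerm_injective h]
  constructor
  · rintro ⟨h1, h2⟩
    refine ⟨fun t ht => hden ht, fun q hq p hp h => ?_, fun a ha b hb h => ?_⟩
    · exact h1 _ hq _ (Q.encodeTerm_mem_termList.2 hp) ((Q.order_iff hp (hden hq)).2 h)
    · exact h2 _ ha _ hb (Q.encodeTerm_mem_termList.2 h)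
  · intro h
    refine ⟨fun x hx y hy hxy => ?_, fun x hx y hy hxy => ?_⟩
    · obtain ⟨q, hq, rfl⟩ := hl' hx
      obtain ⟨p, hp, rfl⟩ := Q.mem_termList.1 hy
      exact h.mem_of_le q hx p hp ((Q.order_iff hp hq).1 hxy)
    · obtain ⟨a, ha, rfl⟩ := hl' hx
      obtain ⟨b, hb, rfl⟩ := hl' hy
      rw [← encodeTerm_sup] at hxy ⊢
      exact h.sup_mem a hx b hy (Q.encodeTerm_mem_termList.1 hxy)

/-- The list is not claimed to be unique: the term list may contain repetitions, so several sublists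
may represent one ideal. -/
theorem exists_mem_idealList (I : Q.Ideals) : ∃ l ∈ (idealList Q.expanded).toList, Q.den l = I.1 := by
  let l := filter (fun x => ∃ t ∈ I.1, x = encodeTerm t) (termList Q.encode)
  have hl : Q.den l = I.1 := by
    ext t
    change encodeTerm t ∈ l.toList ↔ _
    rw [mem_filter, encodeTerm_mem_termList]
    constructor
    · rintro ⟨-, s, hs, h⟩
      rwa [encodeTerm_injective h]
    · exact fun h => ⟨I.2.subset h, t, h, rfl⟩
  refine ⟨l, Q.mem_idealList.2 ⟨filter_mem_sublists _ _, ?_⟩, hl⟩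
  rw [hl]
  exact I.2

theorem incl_iff {l m : Val} (hl : l ∈ (idealList Q.expanded).toList) :
    Incl l m ↔ Q.den l ⊆ Q.den m := by
  refine ⟨fun h t ht => h _ ht, fun h x hx => ?_⟩
  obtain ⟨t, -, rfl⟩ := Q.exists_of_mem_sublists (Q.mem_idealList.1 hl).1 hx
  exact h hx

/-- The homomorphism to the lattice of ideals. -/
def toIdeals : LatticeHom Q.pres.Lat Q.Ideals := TermIdeal.hom Q.saturated

theorem mem_toIdeals {p : Term (Fin Q.pres.n)} {d : Q.pres.Lat} :
    p ∈ (Q.toIdeals d).1 ↔ p ∈ Q.terms ∧ Presented.mk Q.pres.relSet p ≤ d :=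
  TermIdeal.mem_hom Q.saturated fun _ _ _ _ h => h

theorem principalTest_iff {l : Val} (hl : l ∈ (idealList Q.expanded).toList)
    {t : Term (Fin Q.pres.n)} (ht : t ∈ Q.terms) :
    PrincipalTest Q.encode l (encodeTerm t) ↔
      Q.den l = (Q.toIdeals (Presented.mk Q.pres.relSet t)).1 := by
  have hsub := (Q.mem_idealList.1 hl).2.subset
  constructor
  · intro h
    ext p
    rw [mem_toIdeals]
    constructor
    · intro hp
      exact ⟨hsub hp, Order.termLE Q ((h _ (Q.encodeTerm_mem_termList.2 (hsub hp))).1 hp)⟩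
    · rintro ⟨hp, hpt⟩
      exact (h _ (Q.encodeTerm_mem_termList.2 hp)).2 ((Q.order_iff hp ht).2 hpt)
  · intro h x hx
    obtain ⟨p, hp, rfl⟩ := Q.mem_termList.1 hx
    change p ∈ Q.den l ↔ Q.Order p t
    rw [h, mem_toIdeals, mk_le_mk, ← Q.order_iff hp ht]
    exact and_iff_right hp

theorem den_eq_inf_iff {l : Val} (hl : l ∈ (idealList Q.expanded).toList) {j k : Val}
    {J K : Q.Ideals} (hJ : Q.den j = J.1) (hK : Q.den k = K.1) :
    (∀ p ∈ (termList Q.encode).toList, p ∈ l.toList ↔ p ∈ j.toList ∧ p ∈ k.toList) ↔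
      Q.den l = (J ⊓ K).1 := by
  have hsub := (Q.mem_idealList.1 hl).2.subset
  constructor
  · intro h
    ext p
    rw [TermIdeal.mem_inf, ← hJ, ← hK]
    constructor
    · intro hp
      exact (h _ (Q.encodeTerm_mem_termList.2 (hsub hp))).1 hp
    · rintro ⟨h1, h2⟩
      have hp : p ∈ Q.terms := J.2.subset (hJ ▸ h1)
      exact (h _ (Q.encodeTerm_mem_termList.2 hp)).2 ⟨h1, h2⟩
  · intro h x hx
    obtain ⟨p, hp, rfl⟩ := Q.mem_termList.1 hx
    change p ∈ Q.den l ↔ p ∈ Q.den j ∧ p ∈ Q.den k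
    rw [h, TermIdeal.mem_inf, ← hJ, ← hK]

/-- Joins are recognised rather than computed, as least upper bounds among the listed ideals. This
is correct because every ideal is listed. -/
theorem den_eq_sup_iff {l j k : Val} (hl : l ∈ (idealList Q.expanded).toList)
    (hj : j ∈ (idealList Q.expanded).toList) (hk : k ∈ (idealList Q.expanded).toList)
    {J K : Q.Ideals} (hJ : Q.den j = J.1) (hK : Q.den k = K.1) :
    (Incl j l ∧ Incl k l ∧
      ∀ m ∈ (idealList Q.expanded).toList, Incl j m → Incl k m → Incl l m) ↔
      Q.den l = (J ⊔ K).1 := by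
  let I : Q.Ideals := ⟨Q.den l, (Q.mem_idealList.1 hl).2⟩
  rw [Q.incl_iff hj, Q.incl_iff hk, hJ, hK]
  constructor
  · rintro ⟨h1, h2, h3⟩
    have hI : I = J ⊔ K := by
      refine le_antisymm ?_ (sup_le h1 h2)
      obtain ⟨m, hm, hmd⟩ := Q.exists_mem_idealList (J ⊔ K)
      have := h3 m hm
      rw [Q.incl_iff hj, Q.incl_iff hk, Q.incl_iff hl, hJ, hK, hmd] at this
      exact this (le_sup_left : J ≤ J ⊔ K) (le_sup_right : K ≤ J ⊔ K)
    exact congrArg Subtype.val hI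
  · intro h
    rw [h]
    refine ⟨(le_sup_left : J ≤ J ⊔ K), (le_sup_right : K ≤ J ⊔ K), fun m hm => ?_⟩
    rw [Q.incl_iff hj, Q.incl_iff hk, Q.incl_iff hl, hJ, hK, h]
    intro h1 h2
    exact (sup_le h1 h2 : J ⊔ K ≤ ⟨Q.den m, (Q.mem_idealList.1 hm).2⟩)

theorem sublatticeStep_mono (w : Val) : MonoOp (sublatticeStep w) := by
  intro s t x hst
  exact Or.imp_right fun ⟨j, hj, k, hk, h⟩ => ⟨j, hst j hj, k, hst k hk, h⟩

theorem mem_sublatticeList {l : Val} : l ∈ (sublatticeList Q.expanded).toList ↔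
    l ∈ (idealList Q.expanded).toList ∧
      ∃ d ∈ generated Q.genSet, Q.den l = (Q.toIdeals d).1 := by
  constructor
  · intro h
    refine ⟨mem_of_mem_lfp h, ?_⟩
    refine lfp_induction (Q := fun l => ∃ d ∈ generated Q.genSet, Q.den l = (Q.toIdeals d).1) h
      fun st l hst hl h => ?_
    rcases h with ⟨x, hx, h⟩ | ⟨j, hj, k, hk, h⟩
    · obtain ⟨t, ht, rfl⟩ := Q.mem_encode_right.1 hx
      exact ⟨_, subset_generated _ ⟨t, ht, rfl⟩, (Q.principalTest_iff hl (Q.gens_subset ht)).1 h⟩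
    · obtain ⟨⟨d, hd, hjd⟩, hj⟩ := hst j hj
      obtain ⟨⟨e, he, hke⟩, hk⟩ := hst k hk
      rcases h with h | h
      · refine ⟨d ⊓ e, (generated _).inf_mem hd he, ?_⟩
        rw [map_inf]
        exact (Q.den_eq_inf_iff hl hjd hke).1 h
      · refine ⟨d ⊔ e, (generated _).sup_mem hd he, ?_⟩
        rw [map_sup]
        exact (Q.den_eq_sup_iff hl hj hk hjd hke).1 h
  · rintro ⟨hl, d, hd, hld⟩
    -- All lists that represent the image of `d` are required to be found, since there may be more
    -- than one.
    let M : Sublattice Q.pres.Lat :=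
      { carrier := {d | ∀ l ∈ (idealList Q.expanded).toList, Q.den l = (Q.toIdeals d).1 →
          l ∈ (sublatticeList Q.expanded).toList}
        supClosed' := by
          intro d hd e he l hl h
          obtain ⟨j, hj, hjd⟩ := Q.exists_mem_idealList (Q.toIdeals d)
          obtain ⟨k, hk, hke⟩ := Q.exists_mem_idealList (Q.toIdeals e)
          rw [map_sup] at h
          exact mem_lfp (sublatticeStep_mono _) hl (.inr ⟨j, hd j hj hjd, k, he k hk hke,
            .inr ((Q.den_eq_sup_iff hl hj hk hjd hke).2 h)⟩)
        infClosed' := by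
          intro d hd e he l hl h
          obtain ⟨j, hj, hjd⟩ := Q.exists_mem_idealList (Q.toIdeals d)
          obtain ⟨k, hk, hke⟩ := Q.exists_mem_idealList (Q.toIdeals e)
          rw [map_inf] at h
          exact mem_lfp (sublatticeStep_mono _) hl (.inr ⟨j, hd j hj hjd, k, he k hk hke,
            .inl ((Q.den_eq_inf_iff hl hjd hke).2 h)⟩) }
    refine mem_generated.1 hd M ?_ l hl hld
    rintro _ ⟨t, ht, rfl⟩ l hl h
    exact mem_lfp (sublatticeStep_mono _) hl (.inl ⟨_, Q.mem_encode_right.2 ⟨t, ht, rfl⟩,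
      (Q.principalTest_iff hl (Q.gens_subset ht)).2 h⟩)

end SubPres

/-! ### Good elements of a lattice represented by lists -/

theorem goodStep_mono (U : Val) : MonoOp (goodStep U) := by
  intro s t x hst h u hu v hv huv
  exact (h u hu v hv huv).imp_right (Or.imp_right fun k z hz hc => k z hz fun c hcs =>
    hc c (hst c hcs))

/-- The list of the good elements, for a list `U` of sets that represents a lattice. -/
theorem mem_goodList_iff {S : Type} [Lattice S] {U : Val} {rep : Val → S → Prop}
    (h₁ : ∀ l ∈ U.toList, ∃ s, rep l s) (h₂ : ∀ s, ∃ l ∈ U.toList, rep l s)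
    (h₃ : ∀ l ∈ U.toList, ∀ m ∈ U.toList, ∀ s t, rep l s → rep m t → (Incl l m ↔ s ≤ t))
    {l : Val} (hl : l ∈ U.toList) {s : S} (hs : rep l s) :
    l ∈ (goodList U).toList ↔ s ∈ good S := by
  constructor
  · intro h
    have : ∀ s, rep l s → s ∈ good S := by
      refine lfp_induction (Q := fun l => ∀ s, rep l s → s ∈ good S) h
        fun st l hst hl h s hs => mem_good fun u v huv => ?_
      obtain ⟨lu, hlu, hu⟩ := h₂ u
      obtain ⟨lv, hlv, hv⟩ := h₂ v
      have hcov : ∀ z ∈ U.toList, Incl lu z → Incl lv z → Incl l z := by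
        intro lz hlz k1 k2
        obtain ⟨z, hz⟩ := h₁ lz hlz
        refine (h₃ l hl lz hlz s z hs hz).2 (huv.trans (sup_le ?_ ?_))
        · exact (h₃ lu hlu lz hlz u z hu hz).1 k1
        · exact (h₃ lv hlv lz hlz v z hv hz).1 k2
      rcases h lu hlu lv hlv hcov with h | h | h
      · exact .inl ((h₃ l hl lu hlu s u hs hu).1 h)
      · exact .inr (.inl ((h₃ l hl lv hlv s v hs hv).1 h))
      · refine .inr (.inr fun z hz => ?_)
        obtain ⟨lz, hlz, hz'⟩ := h₂ z
        refine (h₃ l hl lz hlz s z hs hz').1 (h lz hlz fun c hc hcuv => ?_)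
        obtain ⟨hcQ, hcU⟩ := hst c hc
        obtain ⟨sc, hsc⟩ := h₁ c hcU
        refine (h₃ c hcU lz hlz sc z hsc hz').2 (hz sc (hcQ sc hsc) ?_)
        exact hcuv.imp (h₃ c hcU lu hlu sc u hsc hu).1 (h₃ c hcU lv hlv sc v hsc hv).1
    exact this s hs
  · intro h
    refine good_subset (Q := {s | ∀ l ∈ U.toList, rep l s → l ∈ (goodList U).toList})
      (fun s hs l hl hls => mem_lfp (goodStep_mono U) hl ?_) h l hl hs
    intro lu hlu lv hlv huv
    obtain ⟨u, hu⟩ := h₁ lu hlu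
    obtain ⟨v, hv⟩ := h₁ lv hlv
    -- The join is represented by some list, and the hypothesis on upper bounds is applied to that
    -- list.
    have hcov : s ≤ u ⊔ v := by
      obtain ⟨lz, hlz, hz⟩ := h₂ (u ⊔ v)
      refine (h₃ l hl lz hlz s _ hls hz).1 (huv lz hlz ?_ ?_)
      · exact (h₃ lu hlu lz hlz u _ hu hz).2 le_sup_left
      · exact (h₃ lv hlv lz hlz v _ hv hz).2 le_sup_right
    rcases hs u v hcov with k | k | k
    · exact .inl ((h₃ l hl lu hlu s u hls hu).2 k)
    · exact .inr (.inl ((h₃ l hl lv hlv s v hls hv).2 k))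
    · refine .inr (.inr fun lz hlz hc => ?_)
      obtain ⟨z, hz⟩ := h₁ lz hlz
      refine (h₃ l hl lz hlz s z hls hz).2 (k z fun c hcQ hcuv => ?_)
      obtain ⟨lc, hlc, hc'⟩ := h₂ c
      refine (h₃ lc hlc lz hlz c z hc' hz).1 (hc lc (hcQ lc hlc hc') ?_)
      exact hcuv.imp (h₃ lc hlc lu hlu c u hc' hu).2 (h₃ lc hlc lv hlv c v hc' hv).2

/-! ### Correctness of the final test -/

namespace SubPres

variable (Q : SubPres)

theorem genSet_eq_range :
    Q.genSet = Set.range fun i : Fin Q.gens.length => Presented.mk Q.pres.relSet (Q.gens.get i) := by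
  ext x
  constructor
  · rintro ⟨t, ht, rfl⟩
    obtain ⟨i, rfl⟩ := List.get_of_mem ht
    exact ⟨i, rfl⟩
  · rintro ⟨i, rfl⟩
    exact ⟨_, List.get_mem _ i, rfl⟩

theorem coe_eval {α L : Type} [Lattice L] {M : Sublattice L} (x : α → M) (t : Term α) :
    ((t.eval x : M) : L) = t.eval fun i => (x i : L) := by
  induction t with
  | var i => rfl
  | sup s t hs ht => rw [Term.eval, Term.eval, Sublattice.coe_sup, hs, ht]
  | inf s t hs ht => rw [Term.eval, Term.eval, Sublattice.coe_inf, hs, ht]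

/-- This is `isLowerBoundedLattice_iff` for the map of `D` onto its image among the ideals. Goodness
has to be computed in that image, not in the lattice of all ideals, because the criterion needs a
surjection. -/
theorem allGood_iff (hD : Q.Dean) : AllGood Q.expanded ↔ IsLowerBoundedLattice Q.Sub := by
  let φ : LatticeHom Q.Sub Q.Ideals := Q.toIdeals.comp (generated Q.genSet).subtype
  have hfin : Finite Q.Ideals := TermIdeal.finite Q.terms_finite
  let x : Fin Q.gens.length → Q.Sub := fun i =>
    ⟨Presented.mk Q.pres.relSet (Q.gens.get i), subset_generated _ ⟨_, List.get_mem _ i, rfl⟩⟩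
  have hmem : ∀ l, l ∈ (sublatticeList Q.expanded).toList ↔
      l ∈ (idealList Q.expanded).toList ∧ ∃ s : homRange φ, Q.den l = s.1.1 := by
    intro l
    rw [mem_sublatticeList]
    refine and_congr_right fun hl => ⟨?_, ?_⟩
    · rintro ⟨d, hd, h⟩
      exact ⟨⟨φ ⟨d, hd⟩, ⟨d, hd⟩, rfl⟩, h⟩
    · rintro ⟨⟨_, ⟨d, hd⟩, rfl⟩, h⟩
      exact ⟨d, hd, h⟩
  have hgood : ∀ {l : Val}, l ∈ (sublatticeList Q.expanded).toList → ∀ {s : homRange φ},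
      Q.den l = s.1.1 →
        (l ∈ (goodList (sublatticeList Q.expanded)).toList ↔ s ∈ good (homRange φ)) := by
    intro l hl s hs
    refine mem_goodList_iff (rep := fun l (s : homRange φ) => Q.den l = s.1.1)
      (fun l hl => ((hmem l).1 hl).2) (fun s => ?_) (fun l hl m hm s t hs ht => ?_) hl hs
    · obtain ⟨l, hl, h⟩ := Q.exists_mem_idealList s.1
      exact ⟨l, (hmem l).2 ⟨hl, s, h⟩, h⟩
    · rw [Q.incl_iff ((hmem l).1 hl).1, hs, ht]
      rfl
  rw [isLowerBoundedLattice_iff x ?_ ?_ (rangeHom φ) (rangeHom_surjective φ) ?_]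
  · constructor
    · intro h i
      obtain ⟨l, hl, hp⟩ := h _ (Q.mem_encode_right.2 ⟨_, List.get_mem _ i, rfl⟩)
      have hlU := mem_of_mem_lfp hl
      refine (hgood hlU ?_).1 hl
      exact (Q.principalTest_iff ((hmem l).1 hlU).1 (Q.gens_subset (List.get_mem _ i))).1 hp
    · intro h y hy
      obtain ⟨t, ht, rfl⟩ := Q.mem_encode_right.1 hy
      obtain ⟨i, rfl⟩ := List.get_of_mem ht
      obtain ⟨l, hl, hld⟩ := Q.exists_mem_idealList (rangeHom φ (x i)).1
      have hlU := (hmem l).2 ⟨hl, _, hld⟩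
      exact ⟨l, (hgood hlU hld).2 (h i), (Q.principalTest_iff hl (Q.gens_subset ht)).2 hld⟩
  · rintro ⟨d, hd⟩
    rw [genSet_eq_range, mem_generated_range] at hd
    obtain ⟨t, rfl⟩ := hd
    exact ⟨t, Subtype.ext (coe_eval x t)⟩
  · have : Set.range x = {y : Q.Sub | (y : Q.pres.Lat) ∈ Q.genSet} := by
      ext y
      constructor
      · rintro ⟨i, rfl⟩
        exact ⟨_, List.get_mem _ i, rfl⟩
      · rintro ⟨t, ht, h⟩
        obtain ⟨i, rfl⟩ := List.get_of_mem ht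
        exact ⟨i, Subtype.ext h.symm⟩
    rw [this]
    exact hD
  · intro i d h
    -- The term of a generator belongs to its own ideal, so an inclusion of ideals places it below
    -- `d`; this is the reflection of inequalities.
    have h1 : Q.gens.get i ∈ (Q.toIdeals (x i : Q.pres.Lat)).1 :=
      Q.mem_toIdeals.2 ⟨Q.gens_subset (List.get_mem _ i), le_rfl⟩
    exact (Q.mem_toIdeals.1 (h h1)).2

end SubPres

/-- Lower boundedness is invariant under isomorphism. -/
theorem IsLowerBoundedLattice.of_orderIso {L M : Type} [Lattice L] [Lattice M]
    (h : IsLowerBoundedLattice L) (e : L ≃o M) : IsLowerBoundedLattice M := by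
  refine h.of_surjective (e : LatticeHom L M) e.surjective fun m => .inr ⟨e.symm m, ?_, ?_⟩
  · exact (e.apply_symm_apply m).ge
  · exact fun x hx => (e.symm_apply_le).2 hx

theorem DeanCondition.of_orderIso {L M : Type} [Lattice L] [Lattice M] (e : L ≃o M) {P : Set M}
    (h : DeanCondition (e ⁻¹' P)) : DeanCondition P := by
  intro S T hS hT hle
  have hinf : (S.map e.symm.toEmbedding).inf' (hS.map) id = e.symm (S.inf' hS id) := by
    rw [Finset.inf'_map, map_finset_inf']
    rfl
  have hsup : (T.map e.symm.toEmbedding).sup' (hT.map) id = e.symm (T.sup' hT id) := by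
    rw [Finset.sup'_map, map_finset_sup']
    rfl
  have := h (S.map e.symm.toEmbedding) (T.map e.symm.toEmbedding) hS.map hT.map
    (by rw [hinf, hsup]; exact e.symm.monotone hle)
  rw [hinf, hsup] at this
  rcases this with ⟨s, hs, h⟩ | ⟨t, ht, h⟩ | ⟨p, hp, h1, h2⟩
  · obtain ⟨s, hs', rfl⟩ := Finset.mem_map.1 hs
    exact .inl ⟨s, hs', e.symm.le_iff_le.1 h⟩
  · obtain ⟨t, ht', rfl⟩ := Finset.mem_map.1 ht
    exact .inr (.inl ⟨t, ht', e.symm.le_iff_le.1 h⟩)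
  · exact .inr (.inr ⟨e p, hp, e.symm_apply_le.1 h1, e.le_symm_apply.1 h2⟩)

/-- The terms that occur in a presentation, as generators of a sublattice, which is the whole
lattice. -/
theorem FinPres.exists_subPres (Q : FinPres) : ∃ G : SubPres,
    G.encode = .node Q.encode (termList (.node Q.encode .nil)) ∧ G.Dean ∧
      (IsLowerBoundedLattice G.Sub ↔ IsLowerBoundedLattice Q.Lat) := by
  let G₀ : SubPres := ⟨Q, []⟩
  have hG₀ : G₀.encode = .node Q.encode .nil := rfl
  -- The generators are read off from the computed term list, so the encoding of `G` is exactly what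
  -- a program obtains from the encoding of `Q`.
  obtain ⟨gens, hgens⟩ := exists_encodeList (enc := encodeTerm (n := Q.n))
    (v := termList (.node Q.encode .nil)) fun x hx => by
      obtain ⟨t, -, rfl⟩ := G₀.mem_termList.1 hx
      exact ⟨t, rfl⟩
  have hmem : ∀ t, t ∈ gens ↔ t ∈ G₀.terms := fun t => by
    rw [← G₀.encodeTerm_mem_termList, hG₀, hgens, toList_encodeList]
    exact (List.mem_map_of_injective encodeTerm_injective).symm
  let G : SubPres := ⟨Q, gens⟩
  have hG : ∀ {t}, t ∈ G₀.terms → Presented.mk Q.relSet t ∈ G.genSet :=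
    fun h => ⟨_, (hmem _).2 h, rfl⟩
  have htop : ∀ x : Q.Lat, x ∈ generated G.genSet := by
    intro x
    obtain ⟨t, rfl⟩ := mk_surjective x
    induction t with
    | var i => exact subset_generated _ (hG (G₀.saturated.var_mem i))
    | sup s t hs ht => exact (generated _).sup_mem hs ht
    | inf s t hs ht => exact (generated _).inf_mem hs ht
  let e : Q.Lat ≃o G.Sub :=
    { toFun := fun x => ⟨x, htop x⟩
      invFun := fun x => x.1
      left_inv := fun _ => rfl
      right_inv := fun _ => rfl
      map_rel_iff' := Iff.rfl }
  refine ⟨G, by rw [hgens]; rfl, ?_, fun h => h.of_orderIso e.symm, fun h => h.of_orderIso e⟩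
  have hdean : DeanCondition G.genSet := (deanCondition_presented Q.relSet).mono (by
    rintro _ ⟨r, hr, rfl | rfl⟩
    · exact hG (G₀.saturated.rel_mem r hr).1
    · exact hG (G₀.saturated.rel_mem r hr).2)
  exact DeanCondition.of_orderIso e hdean

end LatDec

theorem theorem1p6 :
    -- finitely presented lattices
    LatDec.DecidableInExpTime LatDec.FinPres.encode (fun _ => True)
      (fun Q => LatDec.IsLowerBoundedLattice Q.Lat) ∧
    -- their finitely generated sublattices that satisfy Dean's condition
    LatDec.DecidableInExpTime LatDec.SubPres.encode (fun Q => Q.Dean)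
      (fun Q => LatDec.IsLowerBoundedLattice Q.Sub) ∧
    -- the finite lattice `P^∨` and the standard homomorphism
    (∀ Q : LatDec.FinPres, ∃ (S : Type) (_ : Lattice S) (ι : S ↪o Q.Lat)
        (f : LatticeHom Q.Lat S),
      Finite S ∧ Set.range ι = LatDec.joins Q.partialLat ∧
      (∀ d : Q.Lat, IsLUB {w | w ∈ LatDec.joins Q.partialLat ∧ w ≤ d} (ι (f d))) ∧
      Function.Surjective f ∧ LatDec.IsLowerBoundedHom f ∧
      (LatDec.IsLowerBoundedLattice Q.Lat ↔ LatDec.IsLowerBoundedLattice S)) := by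
  refine ⟨?_, ?_, LatDec.FinPres.standardHom⟩
  -- `g` reduces a presentation, in polynomial time, to the sublattice generated by all its terms,
  -- for which Dean's condition is a theorem.
  · let g : LatDec.Val → LatDec.Val := fun u => .node u (LatDec.termList (.node u .nil))
    have hg : LatDec.FP g := .node .id (.termList (.node .id .nil))
    refine LatDec.decidableInExpTime_of_sublists
      (ψ := fun w => LatDec.AllGood (.node (g w.left) w.right)) (l := fun u => LatDec.termList (g u))
      (.allGood (.node (hg.comp (.left .id)) (.right .id))) (.termList hg) fun Q _ => ?_
    obtain ⟨G, hG, hD, hiff⟩ := Q.exists_subPres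
    rw [← hiff, ← G.allGood_iff hD, LatDec.SubPres.expanded, hG]
    rfl
  · exact LatDec.decidableInExpTime_of_sublists (.allGood .id) (.termList .id)
      fun Q hD => Q.allGood_iff hD
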